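/- Let $n\ge 0$ be an integer. For $N\ge 0$ and $k\in\mathbb Z$ let $\widetilde S_{N}^{k}$ be the set of bijections $f:\mathbb Z\to\mathbb Z$ with $f(i+N)=f(i)+N$ for all $i$ and $\sum_{i=1}^{N}(f(i)-i)=kN$, and let $\ell(f)=\#\{(i,j)\in\{1,\dots,N\}\times\mathbb Z : i<j,\ f(i)>f(j)\}$. The usual Bruhat order on $\widetilde S_N^k$ is the reflexive transitive closure of the relation "$g=f\,t_{i,j}$ and $\ell(f)<\ell(g)$", where, for $i\not\equiv j \pmod N$, $t_{i,j}$ swaps $i+mN$ and $j+mN$ for every $m\in\mathbb Z$ and fixes all other integers. The circular Bruhat order $\le$ is the dual of the usual one. A $\rho$-symmetric bounded affine permutation is an $f\in\widetilde S_{2n}^{n}$ such that $i\le f(i)\le i+2n$ for all $i\in\mathbb Z$ and such that $i\mapsto f(i)-n$ is an involution; let $\mathcal B^{R}(n,2n)$ be the set of these, and let $\le_R$ be the restriction of the circular Bruhat order to it. An alignment of $f\in\mathcal B^R(n,2n)$ is a pair of integers $(i,j)$ with $i<j\le f(j)<f(i)$; simultaneous shifts of $i$ and $j$ by multiples of $2n$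 are identified. If $(i,j)$ is an alignment, so is $(f(j)+n,f(i)+n)$, and these two (possibly equal) alignments form one $\rho$-paired alignment. Let $\ell^R(f)$ be the number of $\rho$-paired alignments of $f$ and put $$d^R(f)=\binom{n+1}{2}-\ell^R(f).$$ Then $d^R$ is the rank function of the poset $(\mathcal B^R(n,2n),\le_R)$: it takes nonnegative integer values, $d^R(f)=0$ for every minimal $f$, $d^R(f)<d^R(g)$ whenever $f<_R g$, and $d^R(g)=d^R(f)+1$ whenever $g$ covers $f$ in $\le_R$. -/

import Mathlib

/-- The `(k, N)`-affine permutations: bijections `f : ℤ → ℤ` with `f (i + N) = f i + N` for all `i`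
and `∑_{i=1}^{N} (f i - i) = k N`. -/
@[ext]
structure AffinePerm (N : ℕ) (k : ℤ) where
  toPerm : Equiv.Perm ℤ
  map_add_period : ∀ i : ℤ, toPerm (i + N) = toPerm i + N
  sum_sub : ∑ i ∈ Finset.Icc (1 : ℤ) N, (toPerm i - i) = k * N

namespace AffinePerm

variable {N : ℕ} {k : ℤ}

instance : CoeFun (AffinePerm N k) (fun _ => ℤ → ℤ) := ⟨fun f => f.toPerm⟩

/-- The inversions `(i, j) ∈ [N] × ℤ`, `i < j`, `f i > f j`, of an affine permutation. -/
def inversions (f : AffinePerm N k) : Set (ℤ × ℤ) :=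
  {p | 1 ≤ p.1 ∧ p.1 ≤ N ∧ p.1 < p.2 ∧ f p.2 < f p.1}

/-- The length of an affine permutation: its number of inversions. -/
noncomputable def length (f : AffinePerm N k) : ℕ := f.inversions.ncard

/-- `t` is the affine transposition `t_{i,j}` (with `i ≢ j` modulo `N`): it swaps `i + m N` and
`j + m N` for every integer `m`, and fixes all other integers. These are the reflections of the
affine Coxeter group `AffinePerm N 0`. -/
def IsTransposition (N : ℕ) (i j : ℤ) (t : Equiv.Perm ℤ) : Prop :=
  ¬ i ≡ j [ZMOD N] ∧
  (∀ m : ℤ, t (i + m * N) = j + m * N ∧ t (j + m * N) = i + m * N) ∧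
  ∀ x : ℤ, ¬ x ≡ i [ZMOD N] → ¬ x ≡ j [ZMOD N] → t x = x

/-- An edge of the Bruhat graph: `g = f t` for a reflection `t`, and `g` is longer than `f`. -/
def BruhatStep (f g : AffinePerm N k) : Prop :=
  ∃ (i j : ℤ) (t : Equiv.Perm ℤ), IsTransposition N i j t ∧
    g.toPerm = f.toPerm * t ∧ f.length < g.length

theorem length_le_of_reflTransGen {f g : AffinePerm N k}
    (h : Relation.ReflTransGen BruhatStep f g) : f = g ∨ f.length < g.length := by
  induction h with
  | refl => exact Or.inl rfl
  | tail _ hbc ih =>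
    obtain ⟨_, _, _, _, _, hlt⟩ := hbc
    rcases ih with rfl | h
    · exact Or.inr hlt
    · exact Or.inr (h.trans hlt)

/-- The usual (strong) Bruhat order on affine permutations, in which the shift `i ↦ i + k`
(of length `0`) is minimal. -/
instance : PartialOrder (AffinePerm N k) where
  le f g := Relation.ReflTransGen BruhatStep f g
  le_refl _ := Relation.ReflTransGen.refl
  le_trans _ _ _ := Relation.ReflTransGen.trans
  le_antisymm f g hfg hgf := by
    rcases length_le_of_reflTransGen hfg with h | h
    · exact h
    · rcases length_le_of_reflTransGen hgf with h' | h'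
      · exact h'.symm
      · exact absurd h (lt_asymm h')

/-- `f` is bounded: `i ≤ f i ≤ i + N` for all `i`. -/
def IsBounded (f : AffinePerm N k) : Prop := ∀ i : ℤ, i ≤ f i ∧ f i ≤ i + N

end AffinePerm

/-- The `ρ`-symmetric bounded affine permutations: the bounded `(n, 2n)`-affine permutations `f`
for which `i ↦ f i - n` is an involution. -/
@[ext]
structure SymmBoundedPerm (n : ℕ) where
  toAffinePerm : AffinePerm (2 * n) n
  bounded : toAffinePerm.IsBounded
  symm : Function.Involutive (fun i : ℤ => toAffinePerm i - n)

namespace SymmBoundedPerm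

variable {n : ℕ}

instance : CoeFun (SymmBoundedPerm n) (fun _ => ℤ → ℤ) := ⟨fun f => f.toAffinePerm⟩

/-- The restriction to `ρ`-symmetric bounded affine permutations of the circular Bruhat order,
which is the dual of the usual Bruhat order on `AffinePerm (2 * n) n`. -/
instance : PartialOrder (SymmBoundedPerm n) :=
  PartialOrder.lift (fun f => OrderDual.toDual f.toAffinePerm)
    (fun _ _ h => SymmBoundedPerm.ext (OrderDual.toDual.injective h))

/-- The alignments `i < j ≤ f j < f i` of `f` (not yet taken modulo the period). -/
def Alignment (f : SymmBoundedPerm n) : Type :=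
  {p : ℤ × ℤ // p.1 < p.2 ∧ p.2 ≤ f p.2 ∧ f p.2 < f p.1}

/-- Two alignments are identified if, up to a simultaneous shift of both entries by a multiple of
the period `2n`, they are equal or are the two members `(i, j)` and `(f j + n, f i + n)` of a
`ρ`-paired alignment. -/
def Alignment.Rel (f : SymmBoundedPerm n) (p q : f.Alignment) : Prop :=
  ∃ m : ℤ,
    q.1 = (p.1.1 + m * (2 * n), p.1.2 + m * (2 * n)) ∨
    q.1 = (f p.1.2 + n + m * (2 * n), f p.1.1 + n + m * (2 * n))

/-- The symmetric length `ℓ^R(f)`: the number of `ρ`-paired alignments of `f`, modulo the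
period. -/
noncomputable def symmLength (f : SymmBoundedPerm n) : ℕ := Nat.card (Quot (Alignment.Rel f))

/-- `d^R(f) = binom(n + 1, 2) - ℓ^R(f)`, as an integer. -/
noncomputable def symmDim (f : SymmBoundedPerm n) : ℤ :=
  ((n + 1).choose 2 : ℤ) - f.symmLength

end SymmBoundedPerm

/-- `r` is the rank function of the poset `P`: it takes nonnegative values, vanishes on minimal
elements, is strictly increasing, and increases by exactly one along each cover. -/
structure IsRankFunction {P : Type*} [PartialOrder P] (r : P → ℤ) : Prop where
  nonneg : ∀ x, 0 ≤ r x
  eq_zero_of_isMin : ∀ x, IsMin x → r x = 0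
  strictMono : StrictMono r
  eq_add_one_of_covBy : ∀ x y, x ⋖ y → r y = r x + 1

/-! Write `σ x = f x - n`. Then `σ` is an involution of period `2n` with `|σ x - x| ≤ n`, and the
circular order on the `f` is the reverse of the Bruhat order on the `σ`. By boundedness the
alignments of `f` are exactly the inversions of `σ`, and modulo the period the pairing becomes `(x,
y) ↔ (σ y, σ x)`. The self-paired inversions are the two-cycles, so `ℓ^R` is half the sum of the
affine length and the number of two-cycles (`symmLength_eq_involutionRank`,
`two_mul_involutionRank`).

This number grades the Bruhat order on all periodic involutions
(`PermLE.involutionRank_lt_and_exists`). The argument is the Richardson–Springer action of a simple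
reflection `s`: it replaces `σ` by `s σ s`, or by `σ s` if the two commute, and changes the rank by
exactly one. At an ascent or descent it agrees with a two-sided "multiply by `s` if that goes up
(down)" operator, which is monotone by the lifting property. Induction on the rank of the upper
element then gives strict monotonicity and an involution of rank one more above the lower element.

Boundedness is inherited by smaller elements (`PermLE.abs_sub_le`), so such intermediate involutions
stay in the bounded set and covers change the rank by one. It remains to normalise at the circular
minima, i.e. the Bruhat-maximal bounded `σ`. If some `|σ x - x| < n`, a larger bounded involution
exists (`exists_larger_involution`); so a maximal `σ` moves every point by exactly `n`, and a direct
count gives rank `n(n+1)/2` (`two_mul_involutionRank_of_abs_eq`). Nonnegativity follows by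
descending to a minimum. -/

/-- Commutation with the translation by `N`. -/
def IsPeriodicPerm (N : ℕ) (f : Equiv.Perm ℤ) : Prop := ∀ i : ℤ, f (i + N) = f i + N

namespace IsPeriodicPerm

variable {N : ℕ} {f g : Equiv.Perm ℤ}

theorem add_mul (hf : IsPeriodicPerm N f) (x m : ℤ) : f (x + m * N) = f x + m * N := by
  induction m using Int.induction_on with
  | zero => simp
  | succ k ih => rw [show x + ((k : ℤ) + 1) * N = x + k * N + N by ring, hf, ih]; ring
  | pred k ih =>
    have := hf (x + (-(k : ℤ) - 1) * N)
    rw [show x + (-(k : ℤ) - 1) * N + N = x + -(k : ℤ) * N by ring, ih] at this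
    linarith

theorem inv (hf : IsPeriodicPerm N f) : IsPeriodicPerm N f⁻¹ := fun i => by
  apply f.injective
  rw [hf]
  simp

theorem mul (hf : IsPeriodicPerm N f) (hg : IsPeriodicPerm N g) : IsPeriodicPerm N (f * g) :=
  fun i => by simp [hg i, hf (g i)]

theorem exists_bound (hN : 0 < N) (hf : IsPeriodicPerm N f) :
    ∃ C : ℤ, ∀ x, |f x - x| ≤ C := by
  refine ⟨∑ i ∈ Finset.range N, |f i - i|, fun x => ?_⟩
  have hN' : (0 : ℤ) < N := by exact_mod_cast hN
  have h0 := Int.emod_nonneg x hN'.ne'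
  have h1 := Int.emod_lt_of_pos x hN'
  have hx : x = x % N + x / N * N := by rw [mul_comm]; exact (Int.emod_add_mul_ediv x N).symm
  obtain ⟨k, hk⟩ := Int.eq_ofNat_of_zero_le h0
  have : f x - x = f k - k := by
    rw [hx, hf.add_mul, hk]; ring
  rw [this]
  exact Finset.single_le_sum (f := fun i : ℕ => |f i - i|) (fun _ _ => abs_nonneg _)
    (Finset.mem_range.2 (by omega))

end IsPeriodicPerm

theorem int_dvd_sub_iff {N : ℕ} {x a : ℤ} : (N : ℤ) ∣ x - a ↔ ∃ m : ℤ, x = a + m * N :=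
  ⟨fun ⟨m, hm⟩ => ⟨m, by linarith⟩, fun ⟨m, hm⟩ => ⟨m, by rw [hm]; ring⟩⟩

/-! ### Affine transpositions. -/

/-- The affine transposition exchanging `a + m N` and `b + m N` for all `m`; it is the identity
when `a ≡ b` modulo `N`. -/
def affSwap (N : ℕ) (a b : ℤ) : Equiv.Perm ℤ :=
  if h : (N : ℤ) ∣ b - a then 1 else
    Function.Involutive.toPerm
      (fun x => if (N : ℤ) ∣ x - a then x - a + b else if (N : ℤ) ∣ x - b then x - b + a else x)
      (by
        intro x
        have hba : ¬ (N : ℤ) ∣ a - b := fun h' => h (by simpa using (dvd_neg.2 h'))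
        by_cases h1 : (N : ℤ) ∣ x - a
        · have h2 : ¬ (N : ℤ) ∣ x - a + b - a := fun h' => h (by
            have := dvd_sub h' h1; simpa [sub_eq_add_neg, add_assoc] using (by ring_nf at this ⊢; exact this))
          simp only [h1, if_true]
          rw [if_neg h2, if_pos (by ring_nf at h1 ⊢; exact h1)]
          ring
        · by_cases h3 : (N : ℤ) ∣ x - b
          · simp only [h1, h3, if_true, if_false]
            rw [if_pos (by ring_nf at h3 ⊢; exact h3)]
            ring
          · simp [h1, h3])

section affSwap

variable {N : ℕ} {a b : ℤ}

theorem affSwap_apply (h : ¬ (N : ℤ) ∣ b - a) (x : ℤ) : affSwap N a b x =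
    if (N : ℤ) ∣ x - a then x - a + b else if (N : ℤ) ∣ x - b then x - b + a else x := by
  rw [affSwap, dif_neg h]
  rfl

theorem affSwap_cases (h : ¬ (N : ℤ) ∣ b - a) (x : ℤ) :
    (∃ m : ℤ, x = a + m * N ∧ affSwap N a b x = b + m * N) ∨
    (∃ m : ℤ, x = b + m * N ∧ affSwap N a b x = a + m * N) ∨
    (affSwap N a b x = x ∧ ¬ (N : ℤ) ∣ x - a ∧ ¬ (N : ℤ) ∣ x - b) := by
  rw [affSwap_apply h]
  by_cases h1 : (N : ℤ) ∣ x - a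
  · obtain ⟨m, hm⟩ := int_dvd_sub_iff.1 h1
    left
    exact ⟨m, hm, by rw [if_pos h1, hm]; ring⟩
  · by_cases h2 : (N : ℤ) ∣ x - b
    · obtain ⟨m, hm⟩ := int_dvd_sub_iff.1 h2
      right; left
      exact ⟨m, hm, by rw [if_neg h1, if_pos h2, hm]; ring⟩
    · right; right
      exact ⟨by rw [if_neg h1, if_neg h2], h1, h2⟩

theorem affSwap_left (h : ¬ (N : ℤ) ∣ b - a) (m : ℤ) :
    affSwap N a b (a + m * N) = b + m * N := by
  rw [affSwap_apply h, if_pos (by simp)]; ring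

theorem affSwap_right (h : ¬ (N : ℤ) ∣ b - a) (m : ℤ) :
    affSwap N a b (b + m * N) = a + m * N := by
  rcases affSwap_cases h (b + m * N) with ⟨k, h1, h2⟩ | ⟨k, h1, h2⟩ | ⟨_, _, h2⟩
  · exact absurd (int_dvd_sub_iff.2 ⟨k - m, by linarith⟩) h
  · rw [h2]; linarith
  · exact absurd (by simp) h2

theorem isTransposition_affSwap (h : ¬ (N : ℤ) ∣ b - a) :
    AffinePerm.IsTransposition N a b (affSwap N a b) := by
  refine ⟨fun h' => h (Int.modEq_iff_dvd.1 h'), fun m => ⟨affSwap_left h m, affSwap_right h m⟩,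
    fun x h1 h2 => ?_⟩
  rcases affSwap_cases h x with ⟨k, h3, _⟩ | ⟨k, h3, _⟩ | ⟨h3, _⟩
  · exact absurd (Int.modEq_iff_dvd.2 (int_dvd_sub_iff.2 ⟨-k, by rw [h3]; ring⟩)) h1
  · exact absurd (Int.modEq_iff_dvd.2 (int_dvd_sub_iff.2 ⟨-k, by rw [h3]; ring⟩)) h2
  · exact h3

theorem AffinePerm.IsTransposition.not_dvd {t : Equiv.Perm ℤ}
    (ht : AffinePerm.IsTransposition N a b t) : ¬ (N : ℤ) ∣ b - a :=
  fun h => ht.1 (Int.modEq_iff_dvd.2 h)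

theorem AffinePerm.IsTransposition.eq_affSwap {t : Equiv.Perm ℤ}
    (ht : AffinePerm.IsTransposition N a b t) : t = affSwap N a b := by
  ext x
  rcases affSwap_cases ht.not_dvd x with ⟨k, h3, h4⟩ | ⟨k, h3, h4⟩ | ⟨h3, h4, h5⟩
  · rw [h4, h3, (ht.2.1 k).1]
  · rw [h4, h3, (ht.2.1 k).2]
  · rw [h3, ht.2.2 x]
    · exact fun h => h4 (by simpa using dvd_neg.2 (Int.modEq_iff_dvd.1 h))
    · exact fun h => h5 (by simpa using dvd_neg.2 (Int.modEq_iff_dvd.1 h))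

theorem AffinePerm.IsTransposition.comm {t : Equiv.Perm ℤ}
    (ht : AffinePerm.IsTransposition N a b t) : AffinePerm.IsTransposition N b a t :=
  ⟨fun h => ht.1 h.symm, fun m => (ht.2.1 m).symm, fun x h1 h2 => ht.2.2 x h2 h1⟩

@[simp]
theorem affSwap_affSwap (x : ℤ) : affSwap N a b (affSwap N a b x) = x := by
  unfold affSwap
  split_ifs with h
  · rfl
  · exact Function.Involutive.toPerm_involutive _ x

@[simp]
theorem affSwap_mul_self : affSwap N a b * affSwap N a b = 1 := by
  ext x; simp

@[simp]
theorem affSwap_inv : (affSwap N a b)⁻¹ = affSwap N a b :=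
  inv_eq_of_mul_eq_one_left affSwap_mul_self

theorem isPeriodicPerm_affSwap : IsPeriodicPerm N (affSwap N a b) := by
  intro x
  by_cases h : (N : ℤ) ∣ b - a
  · simp [affSwap, h]
  · rcases affSwap_cases h x with ⟨k, h3, h4⟩ | ⟨k, h3, h4⟩ | ⟨h3, h4, h5⟩
    · rw [h4, h3, show a + k * N + N = a + (k + 1) * N by ring, affSwap_left h]; ring
    · rw [h4, h3, show b + k * N + N = b + (k + 1) * N by ring, affSwap_right h]; ring
    · rw [h3]
      have e1 : ¬ (N : ℤ) ∣ x + N - a := by rwa [add_sub_right_comm, dvd_add_self_right]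
      have e2 : ¬ (N : ℤ) ∣ x + N - b := by rwa [add_sub_right_comm, dvd_add_self_right]
      rw [affSwap_apply h, if_neg e1, if_neg e2]

theorem IsPeriodicPerm.not_dvd {f : Equiv.Perm ℤ} (hf : IsPeriodicPerm N f)
    (h : ¬ (N : ℤ) ∣ b - a) : ¬ (N : ℤ) ∣ f b - f a := by
  intro h'
  obtain ⟨m, hm⟩ := int_dvd_sub_iff.1 h'
  rw [← hf.add_mul] at hm
  exact h (int_dvd_sub_iff.2 ⟨m, f.injective hm⟩)

theorem mul_affSwap_mul_inv {f : Equiv.Perm ℤ} (hf : IsPeriodicPerm N f)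
    (h : ¬ (N : ℤ) ∣ b - a) : f * affSwap N a b * f⁻¹ = affSwap N (f a) (f b) := by
  apply AffinePerm.IsTransposition.eq_affSwap
  refine ⟨fun h' => hf.not_dvd h (Int.modEq_iff_dvd.1 h'), fun m => ⟨?_, ?_⟩, fun x h1 h2 => ?_⟩
  · rw [← hf.add_mul, ← hf.add_mul, ← affSwap_left h]; simp
  · rw [← hf.add_mul, ← hf.add_mul, ← affSwap_right h]; simp
  · rcases affSwap_cases h (f⁻¹ x) with ⟨k, h3, _⟩ | ⟨k, h3, _⟩ | ⟨h3, _⟩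
    · refine absurd (Int.modEq_iff_dvd.2 (int_dvd_sub_iff.2 ⟨-k, ?_⟩)) h1
      rw [Equiv.Perm.inv_eq_iff_eq, hf.add_mul] at h3
      rw [h3]; ring
    · refine absurd (Int.modEq_iff_dvd.2 (int_dvd_sub_iff.2 ⟨-k, ?_⟩)) h2
      rw [Equiv.Perm.inv_eq_iff_eq, hf.add_mul] at h3
      rw [h3]; ring
    · rw [Equiv.Perm.mul_apply, Equiv.Perm.mul_apply, h3]; simp

theorem mul_affSwap {f : Equiv.Perm ℤ} (hf : IsPeriodicPerm N f)
    (h : ¬ (N : ℤ) ∣ b - a) : f * affSwap N a b = affSwap N (f a) (f b) * f := by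
  rw [← mul_affSwap_mul_inv hf h]; simp

theorem affSwap_comm : affSwap N a b = affSwap N b a := by
  by_cases h : (N : ℤ) ∣ b - a
  · have h' : (N : ℤ) ∣ a - b := by simpa using dvd_neg.2 h
    simp [affSwap, h, h']
  · exact (isTransposition_affSwap h).comm.eq_affSwap

theorem affSwap_add_mul (h : ¬ (N : ℤ) ∣ b - a) (m : ℤ) :
    affSwap N (a + m * N) (b + m * N) = affSwap N a b := by
  symm
  apply AffinePerm.IsTransposition.eq_affSwap
  have ht := isTransposition_affSwap h
  refine ⟨?_, fun k => ?_, fun x h1 h2 => ht.2.2 x ?_ ?_⟩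
  · intro h'
    have := Int.modEq_iff_dvd.1 h'
    exact h (by simpa using this)
  · rw [show a + m * N + k * N = a + (m + k) * N by ring,
      show b + m * N + k * N = b + (m + k) * N by ring]
    exact ht.2.1 _
  · exact fun h' => h1 (h'.trans (by simp [Int.ModEq]))
  · exact fun h' => h2 (h'.trans (by simp [Int.ModEq]))

theorem affSwap_apply_left (h : ¬ (N : ℤ) ∣ b - a) : affSwap N a b a = b := by
  simpa using affSwap_left h 0

theorem affSwap_apply_right (h : ¬ (N : ℤ) ∣ b - a) : affSwap N a b b = a := by
  simpa using affSwap_right h 0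

end affSwap

/-! ### Counting pairs modulo the period. -/

/-- Simultaneous translation of a pair by `m N`. -/
def shiftPair (N : ℕ) (m : ℤ) (p : ℤ × ℤ) : ℤ × ℤ := (p.1 + m * N, p.2 + m * N)

/-- The number of elements modulo the period of a translation invariant set of pairs. -/
noncomputable def orbitCount (N : ℕ) (S : Set (ℤ × ℤ)) : ℕ :=
  {p | p ∈ S ∧ 1 ≤ p.1 ∧ p.1 ≤ N}.ncard

/-- The translate of a pair whose first entry lies in `{1, …, N}`. -/
def normPair (N : ℕ) (p : ℤ × ℤ) : ℤ × ℤ := shiftPair N (-((p.1 - 1) / N)) p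

section orbitCount

variable {N : ℕ} {S T : Set (ℤ × ℤ)}

theorem normPair_mem (hN : 0 < N) (p : ℤ × ℤ) :
    1 ≤ (normPair N p).1 ∧ (normPair N p).1 ≤ N := by
  have hN' : (0 : ℤ) < N := by exact_mod_cast hN
  have h0 := Int.emod_nonneg (p.1 - 1) hN'.ne'
  have h1 := Int.emod_lt_of_pos (p.1 - 1) hN'
  have h2 := Int.emod_add_mul_ediv (p.1 - 1) N
  simp only [normPair, shiftPair]
  constructor <;> linarith

theorem eq_of_mem_window {x m : ℤ} (h1 : 1 ≤ x) (h2 : x ≤ N)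
    (h3 : 1 ≤ x + m * N) (h4 : x + m * N ≤ N) : m = 0 := by
  have hN' : (0 : ℤ) < N := by linarith
  have a1 : m * N < 1 * N := by linarith
  have a2 : (-1) * N < m * N := by linarith
  have := lt_of_mul_lt_mul_right a1 hN'.le
  have := lt_of_mul_lt_mul_right a2 hN'.le
  omega

theorem finite_window {C : ℤ} (hS : ∀ p ∈ S, |p.2 - p.1| ≤ C) :
    {p | p ∈ S ∧ 1 ≤ p.1 ∧ p.1 ≤ N}.Finite := by
  refine (Set.finite_Icc ((1 : ℤ), 1 - C) ((N : ℤ), N + C)).subset ?_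
  rintro ⟨x, y⟩ ⟨h, h1, h2⟩
  have := abs_le.1 (hS _ h)
  simp only at this h1 h2
  exact ⟨⟨h1, by simp only; linarith⟩, ⟨h2, by simp only; linarith⟩⟩

/-- An equivariant map may push the first entry out of the window `{1, …, N}`; composing with
`normPair` brings it back and stays injective on the window. -/
theorem orbitCount_image (hN : 0 < N) {φ : ℤ × ℤ → ℤ × ℤ} (hinj : Set.InjOn φ S)
    (hS : ∀ p ∈ S, ∀ m, shiftPair N m p ∈ S)
    (hφ : ∀ p ∈ S, ∀ m, φ (shiftPair N m p) = shiftPair N m (φ p)) :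
    orbitCount N (φ '' S) = orbitCount N S := by
  have : {p | p ∈ φ '' S ∧ 1 ≤ p.1 ∧ p.1 ≤ N} =
      (normPair N ∘ φ) '' {p | p ∈ S ∧ 1 ≤ p.1 ∧ p.1 ≤ N} := by
    ext q
    constructor
    · rintro ⟨⟨p, hp, rfl⟩, h1, h2⟩
      refine ⟨normPair N p, ⟨hS _ hp _, normPair_mem hN p⟩, ?_⟩
      simp only [Function.comp]
      set k := -((p.1 - 1) / N) with hk
      have e : φ (normPair N p) = shiftPair N k (φ p) := hφ _ hp _
      rw [e]
      have h3 := normPair_mem hN (shiftPair N k (φ p))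
      simp only [normPair] at h3 ⊢
      set l := -(((shiftPair N k (φ p)).1 - 1) / N)
      have : l + k = 0 := by
        refine eq_of_mem_window h1 h2 ?_ ?_
        · have := h3.1; simp only [shiftPair] at this; linarith
        · have := h3.2; simp only [shiftPair] at this; linarith
      have hl : l = -k := by linarith
      rw [hl]
      ext <;> simp [shiftPair]
    · rintro ⟨p, ⟨hp, _⟩, rfl⟩
      refine ⟨⟨shiftPair N _ p, hS _ hp _, hφ _ hp _⟩, normPair_mem hN _⟩
  unfold orbitCount
  rw [this]
  apply Set.InjOn.ncard_image
  rintro p ⟨hp, hp1, hp2⟩ q ⟨hq, hq1, hq2⟩ h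
  simp only [Function.comp, normPair] at h
  set k := -(((φ p).1 - 1) / (N : ℤ))
  set l := -(((φ q).1 - 1) / (N : ℤ))
  rw [← hφ _ hp, ← hφ _ hq] at h
  have h := hinj (hS _ hp _) (hS _ hq _) h
  have hx := congrArg Prod.fst h
  have hy := congrArg Prod.snd h
  simp only [shiftPair] at hx hy
  have : k - l = 0 := by
    refine eq_of_mem_window hp1 hp2 ?_ ?_ <;>
    · have : p.1 + (k - l) * N = q.1 := by linarith
      rw [this]; assumption
  have hkl : k = l := by linarith
  rw [hkl] at hx hy
  ext <;> linarith

theorem orbitCount_union {C : ℤ} (hS : ∀ p ∈ S, |p.2 - p.1| ≤ C)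
    (hT : ∀ p ∈ T, |p.2 - p.1| ≤ C) (h : ∀ p ∈ S, p ∉ T) :
    orbitCount N (S ∪ T) = orbitCount N S + orbitCount N T := by
  unfold orbitCount
  rw [← Set.ncard_union_eq _ (finite_window hS) (finite_window hT)]
  · congr 1
    ext p
    simp only [Set.mem_union, Set.mem_ofPred_eq]
    tauto
  · rw [Set.disjoint_left]
    exact fun p hp hq => h p hp.1 hq.1

theorem orbitCount_mono {C : ℤ} (hT : ∀ p ∈ T, |p.2 - p.1| ≤ C) (h : S ⊆ T) :
    orbitCount N S ≤ orbitCount N T :=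
  Set.ncard_le_ncard (fun _ hp => ⟨h hp.1, hp.2⟩) (finite_window hT)

theorem orbitCount_orbit (hN : 0 < N) (p : ℤ × ℤ) :
    orbitCount N (Set.range fun m => shiftPair N m p) = 1 := by
  unfold orbitCount
  rw [Set.ncard_eq_one]
  refine ⟨normPair N p, ?_⟩
  ext q
  simp only [Set.mem_ofPred_eq, Set.mem_singleton_iff, Set.mem_range]
  constructor
  · rintro ⟨⟨m, rfl⟩, h1, h2⟩
    have h3 := normPair_mem hN p
    simp only [normPair] at h3 ⊢
    set k := -((p.1 - 1) / (N : ℤ))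
    have : k - m = 0 := by
      refine eq_of_mem_window h1 h2 ?_ ?_
      · have := h3.1; simp only [shiftPair] at this ⊢; linarith
      · have := h3.2; simp only [shiftPair] at this ⊢; linarith
    rw [show k = m by linarith]
  · rintro rfl
    exact ⟨⟨_, rfl⟩, normPair_mem hN p⟩

end orbitCount

/-! ### Affine length and its behaviour under reflections. -/

/-- The inversions of a permutation of `ℤ`. -/
def invSet (f : Equiv.Perm ℤ) : Set (ℤ × ℤ) := {p | p.1 < p.2 ∧ f p.2 < f p.1}

/-- The affine length: the number of inversions modulo the period. -/
noncomputable def affLength (N : ℕ) (f : Equiv.Perm ℤ) : ℕ := orbitCount N (invSet f)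

/-- The map on pairs that carries inversions of `f` to inversions of `f * t`. -/
def invMap (t : Equiv.Perm ℤ) (p : ℤ × ℤ) : ℤ × ℤ :=
  if t p.1 < t p.2 then (t p.1, t p.2) else p

section length

variable {N : ℕ} {a b : ℤ} {f : Equiv.Perm ℤ}

theorem IsPeriodicPerm.shiftPair_mem_invSet (hf : IsPeriodicPerm N f) :
    ∀ p ∈ invSet f, ∀ m, shiftPair N m p ∈ invSet f := by
  rintro ⟨x, y⟩ ⟨h1, h2⟩ m
  simp only [shiftPair, invSet, Set.mem_ofPred_eq, hf.add_mul] at *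
  constructor <;> linarith

theorem IsPeriodicPerm.invSet_bound (hN : 0 < N) (hf : IsPeriodicPerm N f) :
    ∃ C : ℤ, ∀ p ∈ invSet f, |p.2 - p.1| ≤ C := by
  obtain ⟨C, hC⟩ := hf.exists_bound hN
  refine ⟨2 * C, ?_⟩
  rintro ⟨x, y⟩ ⟨h1, h2⟩
  have hx := abs_le.1 (hC x)
  have hy := abs_le.1 (hC y)
  simp only at h1 h2 ⊢
  rw [abs_le]
  constructor <;> linarith

theorem invMap_injective (t : Equiv.Perm ℤ) (ht : ∀ x, t (t x) = x) :
    Set.InjOn (invMap t) {p | p.1 < p.2} := by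
  rintro ⟨x, y⟩ h ⟨x', y'⟩ h' e
  simp only [invMap, Set.mem_ofPred_eq] at *
  split_ifs at e with h1 h2 h2
  · simpa using e
  · simp only [Prod.mk.injEq] at e
    rw [← e.1, ← e.2, ht, ht] at h2
    exact absurd h h2
  · simp only [Prod.mk.injEq] at e
    rw [e.1, e.2, ht, ht] at h1
    exact absurd h' h1
  · exact e

theorem invMap_shiftPair {t : Equiv.Perm ℤ} (ht : IsPeriodicPerm N t) (p : ℤ × ℤ) (m : ℤ) :
    invMap t (shiftPair N m p) = shiftPair N m (invMap t p) := by
  simp only [invMap, shiftPair, ht.add_mul, add_lt_add_iff_right]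
  split_ifs <;> rfl

/-- If the swap `t` does not keep `x < y` in order, it cannot move `x` down or `y` up. Since `f a <
f b`, this gives `f (t x) ≥ f x > f y ≥ f (t y)`, so the unmoved pair is still an inversion. -/
theorem invMap_mem (hf : IsPeriodicPerm N f) (hd : ¬ (N : ℤ) ∣ b - a) (hab : a < b)
    (hfab : f a < f b) : ∀ p ∈ invSet f, invMap (affSwap N a b) p ∈ invSet (f * affSwap N a b) := by
  rintro ⟨x, y⟩ ⟨h1, h2⟩
  simp only [invMap] at *
  split_ifs with h
  · exact ⟨h, by simpa using h2⟩
  · refine ⟨h1, ?_⟩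
    simp only [Equiv.Perm.mul_apply]
    rcases affSwap_cases hd x with ⟨k, h3, h4⟩ | ⟨k, h3, h4⟩ | ⟨h4, _, _⟩ <;>
    rcases affSwap_cases hd y with ⟨l, h5, h6⟩ | ⟨l, h5, h6⟩ | ⟨h6, _, _⟩ <;>
    rw [h4, h6] at h ⊢ <;> (try subst h3) <;> (try subst h5) <;>
    (try simp only [hf.add_mul] at *) <;> linarith

theorem orbit_subset_invSet (hf : IsPeriodicPerm N f) (hd : ¬ (N : ℤ) ∣ b - a) (hab : a < b)
    (hfab : f a < f b) :
    (Set.range fun m => shiftPair N m (a, b)) ⊆ invSet (f * affSwap N a b) := by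
  rintro _ ⟨m, rfl⟩
  simp only [shiftPair, invSet, Set.mem_ofPred_eq, Equiv.Perm.mul_apply, affSwap_left hd,
    affSwap_right hd, hf.add_mul]
  constructor <;> linarith

theorem not_mem_orbit (hf : IsPeriodicPerm N f) (hd : ¬ (N : ℤ) ∣ b - a) (hab : a < b)
    (hfab : f a < f b) : ∀ p ∈ invMap (affSwap N a b) '' invSet f,
      p ∉ Set.range fun m => shiftPair N m (a, b) := by
  rintro _ ⟨⟨x, y⟩, ⟨h1, h2⟩, rfl⟩ ⟨m, h3⟩
  simp only [invMap, shiftPair] at *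
  split_ifs at h3 with h
  · simp only [Prod.mk.injEq] at h3
    have hx := congrArg (affSwap N a b) h3.1
    have hy := congrArg (affSwap N a b) h3.2
    rw [affSwap_left hd, affSwap_affSwap] at hx
    rw [affSwap_right hd, affSwap_affSwap] at hy
    linarith
  · simp only [Prod.mk.injEq] at h3
    rw [← h3.1, ← h3.2, hf.add_mul, hf.add_mul] at h2
    linarith

theorem orbit_bound : ∀ p ∈ Set.range fun m => shiftPair N m (a, b), |p.2 - p.1| ≤ |b - a| := by
  rintro _ ⟨m, rfl⟩
  simp [shiftPair]

theorem orbitCount_union_orbit (hN : 0 < N) (hf : IsPeriodicPerm N f)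
    (hd : ¬ (N : ℤ) ∣ b - a) (hab : a < b) (hfab : f a < f b) :
    orbitCount N (invMap (affSwap N a b) '' invSet f ∪ Set.range fun m => shiftPair N m (a, b)) =
      affLength N f + 1 := by
  obtain ⟨C, hC⟩ := (hf.mul (isPeriodicPerm_affSwap (a := a) (b := b))).invSet_bound hN
  rw [orbitCount_union (C := C) _ _ (not_mem_orbit hf hd hab hfab), orbitCount_orbit hN,
    orbitCount_image hN _ hf.shiftPair_mem_invSet
      (fun p _ m => invMap_shiftPair isPeriodicPerm_affSwap p m), affLength]
  · exact (invMap_injective _ affSwap_affSwap).mono fun p hp => hp.1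
  · rintro _ ⟨p, hp, rfl⟩
    exact hC _ (invMap_mem hf hd hab hfab p hp)
  · exact fun p hp => hC p (orbit_subset_invSet hf hd hab hfab hp)

/-- The transported inversions of `f` and the orbit of `(a, b)` are disjoint sets of inversions of
the product. -/
theorem affLength_lt (hN : 0 < N) (hf : IsPeriodicPerm N f)
    (hd : ¬ (N : ℤ) ∣ b - a) (hab : a < b) (hfab : f a < f b) :
    affLength N f < affLength N (f * affSwap N a b) := by
  rw [Nat.lt_iff_add_one_le, ← orbitCount_union_orbit hN hf hd hab hfab]
  obtain ⟨C, hC⟩ := (hf.mul (isPeriodicPerm_affSwap (a := a) (b := b))).invSet_bound hN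
  refine orbitCount_mono hC (Set.union_subset ?_ (orbit_subset_invSet hf hd hab hfab))
  rintro _ ⟨p, hp, rfl⟩
  exact invMap_mem hf hd hab hfab p hp

/-- This is the special feature of simple reflections: it makes the length change exactly one and
drives the lifting property. -/
theorem affSwap_succ_lt {i x y : ℤ} (hd : ¬ (N : ℤ) ∣ i + 1 - i) (h : x < y) :
    affSwap N i (i + 1) x < affSwap N i (i + 1) y ∨
      ∃ m : ℤ, x = i + m * N ∧ y = i + 1 + m * N := by
  by_contra! hc
  obtain ⟨h0, hc⟩ := hc
  have hne : affSwap N i (i + 1) y ≠ affSwap N i (i + 1) x := fun e => by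
    have := (affSwap N i (i + 1)).injective e; omega
  rcases affSwap_cases hd x with ⟨k, h3, h4⟩ | ⟨k, h3, h4⟩ | ⟨h4, _, _⟩ <;>
  rcases affSwap_cases hd y with ⟨l, h5, h6⟩ | ⟨l, h5, h6⟩ | ⟨h6, h7, h8⟩ <;>
  rw [h4, h6] at h0 hne
  · omega
  · exact hc k h3 (by omega)
  · exact h8 (int_dvd_sub_iff.2 ⟨k, by omega⟩)
  all_goals omega

theorem affLength_mul_succ {i : ℤ} (hN : 0 < N) (hd : ¬ (N : ℤ) ∣ i + 1 - i)
    (hf : IsPeriodicPerm N f) (hfab : f i < f (i + 1)) :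
    affLength N (f * affSwap N i (i + 1)) = affLength N f + 1 := by
  have hab : i < i + 1 := by omega
  rw [← orbitCount_union_orbit hN hf hd hab hfab, affLength]
  congr 1
  apply Set.Subset.antisymm
  · rintro ⟨x, y⟩ ⟨h1, h2⟩
    simp only [Equiv.Perm.mul_apply] at h1 h2
    rcases affSwap_succ_lt hd h1 with h | ⟨m, rfl, rfl⟩
    · left
      refine ⟨(affSwap N i (i + 1) x, affSwap N i (i + 1) y), ⟨h, h2⟩, ?_⟩
      simp [invMap, h1]
    · right
      exact ⟨m, rfl⟩
  · refine Set.union_subset ?_ (orbit_subset_invSet hf hd hab hfab)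
    rintro _ ⟨p, hp, rfl⟩
    exact invMap_mem hf hd hab hfab p hp

theorem affLength_inv (hN : 0 < N) (hf : IsPeriodicPerm N f) :
    affLength N f⁻¹ = affLength N f := by
  rw [affLength, affLength, ← orbitCount_image hN (φ := fun p => (f p.2, f p.1)) (S := invSet f) _
    hf.shiftPair_mem_invSet]
  · congr 1
    ext ⟨x, y⟩
    constructor
    · rintro ⟨h1, h2⟩
      exact ⟨(f⁻¹ y, f⁻¹ x), ⟨h2, by simpa using h1⟩, by simp⟩
    · rintro ⟨⟨a, b⟩, ⟨h1, h2⟩, h⟩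
      simp only [Prod.mk.injEq] at h
      rw [← h.1, ← h.2]
      exact ⟨h2, by simpa using h1⟩
  · intro p _ m
    simp [shiftPair, hf.add_mul]
  · rintro ⟨x, y⟩ _ ⟨x', y'⟩ _ h
    simp only [Prod.mk.injEq, EmbeddingLike.apply_eq_iff_eq] at h
    ext
    · exact h.2
    · exact h.1

end length

/-! ### Bruhat order and the lifting property. -/

/-- An edge of the Bruhat graph on permutations of `ℤ`, in terms of one-line notation. -/
def PermStep (N : ℕ) (f g : Equiv.Perm ℤ) : Prop :=
  ∃ a b : ℤ, ¬ (N : ℤ) ∣ b - a ∧ a < b ∧ f a < f b ∧ g = f * affSwap N a b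

/-- The Bruhat order on periodic permutations of `ℤ`. -/
def PermLE (N : ℕ) : Equiv.Perm ℤ → Equiv.Perm ℤ → Prop := Relation.ReflTransGen (PermStep N)

section order

variable {N : ℕ} {f g : Equiv.Perm ℤ} {i : ℤ}

theorem PermStep.isPeriodicPerm (h : PermStep N f g) (hf : IsPeriodicPerm N f) :
    IsPeriodicPerm N g := by
  obtain ⟨a, b, _, _, _, rfl⟩ := h
  exact hf.mul isPeriodicPerm_affSwap

theorem PermLE.isPeriodicPerm (h : PermLE N f g) (hf : IsPeriodicPerm N f) :
    IsPeriodicPerm N g := by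
  induction h with
  | refl => exact hf
  | tail _ h ih => exact h.isPeriodicPerm ih

theorem PermStep.inv (h : PermStep N f g) (hf : IsPeriodicPerm N f) : PermStep N f⁻¹ g⁻¹ := by
  obtain ⟨a, b, hd, hab, hfab, rfl⟩ := h
  refine ⟨f a, f b, hf.not_dvd hd, hfab, by simpa using hab, ?_⟩
  rw [← mul_affSwap_mul_inv hf hd, mul_inv_rev, affSwap_inv]
  group

theorem PermLE.inv (h : PermLE N f g) (hf : IsPeriodicPerm N f) : PermLE N f⁻¹ g⁻¹ := by
  induction h with
  | refl => exact Relation.ReflTransGen.refl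
  | tail h1 h2 ih => exact ih.tail (h2.inv (PermLE.isPeriodicPerm h1 hf))

theorem PermLE.affLength_le (hN : 0 < N) (h : PermLE N f g) (hf : IsPeriodicPerm N f) :
    f = g ∨ affLength N f < affLength N g := by
  induction h with
  | refl => exact Or.inl rfl
  | tail h1 h2 ih =>
    obtain ⟨a, b, hd, hab, hfab, rfl⟩ := h2
    have := affLength_lt hN (PermLE.isPeriodicPerm h1 hf) hd hab hfab
    rcases ih with rfl | ih
    · exact Or.inr this
    · exact Or.inr (ih.trans this)

theorem PermLE.antisymm (hN : 0 < N) (hf : IsPeriodicPerm N f) (h : PermLE N f g)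
    (h' : PermLE N g f) : f = g := by
  rcases h.affLength_le hN hf with e | e
  · exact e
  · rcases h'.affLength_le hN (h.isPeriodicPerm hf) with e' | e'
    · exact e'.symm
    · omega

/-- Conjugating `t_{a,b}` by the simple reflection `s` gives `t_{s a, s b}`, and `s a < s b` unless
`t_{a,b}` is `s` itself. -/
theorem PermStep.mul_affSwap_succ (hd : ¬ (N : ℤ) ∣ i + 1 - i) (h : PermStep N f g) :
    PermStep N (f * affSwap N i (i + 1)) (g * affSwap N i (i + 1)) ∨
      g = f * affSwap N i (i + 1) := by
  obtain ⟨a, b, hab', hab, hfab, rfl⟩ := h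
  rcases affSwap_succ_lt hd hab with h | ⟨m, rfl, rfl⟩
  · left
    refine ⟨affSwap N i (i + 1) a, affSwap N i (i + 1) b,
      isPeriodicPerm_affSwap.not_dvd hab', h, by simpa using hfab, ?_⟩
    rw [mul_assoc, mul_assoc, mul_affSwap isPeriodicPerm_affSwap
      (isPeriodicPerm_affSwap.not_dvd hab')]
    simp
  · right
    rw [affSwap_add_mul hd]

/-- Multiply a chain by `s` edge by edge from the bottom. Either every edge survives, or some edge
is multiplication by `s` and the translated chain rejoins the original one there. -/
theorem PermLE.mul_affSwap_succ_or_left (hd : ¬ (N : ℤ) ∣ i + 1 - i) (h : PermLE N f g) :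
    PermLE N (f * affSwap N i (i + 1)) (g * affSwap N i (i + 1)) ∨
      PermLE N (f * affSwap N i (i + 1)) g := by
  induction h using Relation.ReflTransGen.head_induction_on with
  | refl => exact Or.inl .refl
  | head h1 h2 ih =>
    rcases h1.mul_affSwap_succ hd with h | h
    · exact ih.imp (.head h) (.head h)
    · exact Or.inr (h ▸ h2)

theorem PermLE.mul_affSwap_succ_or_right (hd : ¬ (N : ℤ) ∣ i + 1 - i) (h : PermLE N f g) :
    PermLE N (f * affSwap N i (i + 1)) (g * affSwap N i (i + 1)) ∨
      PermLE N f (g * affSwap N i (i + 1)) := by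
  induction h with
  | refl => exact Or.inl .refl
  | tail h1 h2 ih =>
    rcases h2.mul_affSwap_succ hd with h | rfl
    · exact ih.imp (·.tail h) (·.tail h)
    · right
      rw [mul_assoc, affSwap_mul_self, mul_one]
      exact h1

/-- The larger of `f` and `f * s` for the simple reflection `s` exchanging `i` and `i + 1`. -/
def rightUp (N : ℕ) (i : ℤ) (f : Equiv.Perm ℤ) : Equiv.Perm ℤ :=
  if f i < f (i + 1) then f * affSwap N i (i + 1) else f

/-- The smaller of `f` and `f * s` for the simple reflection `s` exchanging `i` and `i + 1`. -/
def rightDown (N : ℕ) (i : ℤ) (f : Equiv.Perm ℤ) : Equiv.Perm ℤ :=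
  if f i < f (i + 1) then f else f * affSwap N i (i + 1)

theorem permStep_mul_affSwap_succ (hd : ¬ (N : ℤ) ∣ i + 1 - i) (h : f i < f (i + 1)) :
    PermStep N f (f * affSwap N i (i + 1)) :=
  ⟨i, i + 1, hd, by omega, h, rfl⟩

theorem permStep_mul_affSwap_succ' (hd : ¬ (N : ℤ) ∣ i + 1 - i) (h : ¬ f i < f (i + 1)) :
    PermStep N (f * affSwap N i (i + 1)) f := by
  refine ⟨i, i + 1, hd, by omega, ?_, by simp [mul_assoc]⟩
  have : f i ≠ f (i + 1) := fun e => by have := f.injective e; omega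
  simp only [Equiv.Perm.mul_apply, affSwap_apply_left hd, affSwap_apply_right hd]
  omega

theorem le_rightUp (hd : ¬ (N : ℤ) ∣ i + 1 - i) : PermLE N f (rightUp N i f) := by
  unfold rightUp
  split_ifs with h
  · exact .single (permStep_mul_affSwap_succ hd h)
  · exact .refl

theorem mul_le_rightUp (hd : ¬ (N : ℤ) ∣ i + 1 - i) :
    PermLE N (f * affSwap N i (i + 1)) (rightUp N i f) := by
  unfold rightUp
  split_ifs with h
  · exact .refl
  · exact .single (permStep_mul_affSwap_succ' hd h)

theorem rightDown_le (hd : ¬ (N : ℤ) ∣ i + 1 - i) : PermLE N (rightDown N i f) f := by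
  unfold rightDown
  split_ifs with h
  · exact .refl
  · exact .single (permStep_mul_affSwap_succ' hd h)

theorem rightDown_le_mul (hd : ¬ (N : ℤ) ∣ i + 1 - i) :
    PermLE N (rightDown N i f) (f * affSwap N i (i + 1)) := by
  unfold rightDown
  split_ifs with h
  · exact .single (permStep_mul_affSwap_succ hd h)
  · exact .refl

/-- The lifting property, stated as monotonicity so that it can be iterated on both sides. -/
theorem PermLE.rightUp (hd : ¬ (N : ℤ) ∣ i + 1 - i) (h : PermLE N f g) :
    PermLE N (rightUp N i f) (rightUp N i g) := by
  rw [_root_.rightUp]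
  split_ifs
  · rcases h.mul_affSwap_succ_or_left hd with h' | h'
    · exact h'.trans (mul_le_rightUp hd)
    · exact h'.trans (le_rightUp hd)
  · exact h.trans (le_rightUp hd)

theorem PermLE.rightDown (hd : ¬ (N : ℤ) ∣ i + 1 - i) (h : PermLE N f g) :
    PermLE N (rightDown N i f) (rightDown N i g) := by
  rw [_root_.rightDown.eq_1 N i g]
  split_ifs
  · exact (rightDown_le hd).trans h
  · rcases h.mul_affSwap_succ_or_right hd with h' | h'
    · exact (rightDown_le_mul hd).trans h'
    · exact (rightDown_le hd).trans h'

theorem isPeriodicPerm_rightUp (hf : IsPeriodicPerm N f) : IsPeriodicPerm N (rightUp N i f) := by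
  unfold rightUp
  split_ifs
  · exact hf.mul isPeriodicPerm_affSwap
  · exact hf

theorem isPeriodicPerm_rightDown (hf : IsPeriodicPerm N f) :
    IsPeriodicPerm N (rightDown N i f) := by
  unfold rightDown
  split_ifs
  · exact hf
  · exact hf.mul isPeriodicPerm_affSwap

/-- The two-sided version of `rightUp`. -/
def biUp (N : ℕ) (i : ℤ) (f : Equiv.Perm ℤ) : Equiv.Perm ℤ := (rightUp N i (rightUp N i f)⁻¹)⁻¹

/-- The two-sided version of `rightDown`. -/
def biDown (N : ℕ) (i : ℤ) (f : Equiv.Perm ℤ) : Equiv.Perm ℤ :=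
  (rightDown N i (rightDown N i f)⁻¹)⁻¹

theorem PermLE.biUp (hd : ¬ (N : ℤ) ∣ i + 1 - i) (hf : IsPeriodicPerm N f) (h : PermLE N f g) :
    PermLE N (biUp N i f) (biUp N i g) :=
  (((h.rightUp hd).inv (isPeriodicPerm_rightUp hf)).rightUp hd).inv
    (isPeriodicPerm_rightUp (isPeriodicPerm_rightUp hf).inv)

theorem PermLE.biDown (hd : ¬ (N : ℤ) ∣ i + 1 - i) (hf : IsPeriodicPerm N f)
    (h : PermLE N f g) : PermLE N (biDown N i f) (biDown N i g) :=
  (((h.rightDown hd).inv (isPeriodicPerm_rightDown hf)).rightDown hd).inv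
    (isPeriodicPerm_rightDown (isPeriodicPerm_rightDown hf).inv)

theorem le_biUp (hd : ¬ (N : ℤ) ∣ i + 1 - i) (hf : IsPeriodicPerm N f) :
    PermLE N f (biUp N i f) := by
  have h := (le_rightUp (f := (rightUp N i f)⁻¹) hd).inv (isPeriodicPerm_rightUp hf).inv
  rw [inv_inv] at h
  exact (le_rightUp hd).trans h

end order

/-! ### The Richardson–Springer action on involutions. -/

/-- The action of a simple reflection `s` on an involution `σ`: the conjugate `s σ s`, or `σ s` if
`s` and `σ` commute. -/
noncomputable def richardsonSpringer (N : ℕ) (i : ℤ) (σ : Equiv.Perm ℤ) : Equiv.Perm ℤ := by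
  classical
  exact if σ * affSwap N i (i + 1) = affSwap N i (i + 1) * σ then σ * affSwap N i (i + 1)
    else affSwap N i (i + 1) * σ * affSwap N i (i + 1)

section involution

variable {N : ℕ} {σ : Equiv.Perm ℤ} {i : ℤ}

theorem richardsonSpringer_of_comm
    (h : σ * affSwap N i (i + 1) = affSwap N i (i + 1) * σ) :
    richardsonSpringer N i σ = σ * affSwap N i (i + 1) := by
  simp only [richardsonSpringer, if_pos h]

theorem richardsonSpringer_of_not_comm
    (h : ¬ σ * affSwap N i (i + 1) = affSwap N i (i + 1) * σ) :
    richardsonSpringer N i σ = affSwap N i (i + 1) * σ * affSwap N i (i + 1) := by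
  simp only [richardsonSpringer, if_neg h]

theorem richardsonSpringer_isPeriodic (hσ : IsPeriodicPerm N σ) :
    IsPeriodicPerm N (richardsonSpringer N i σ) := by
  by_cases h : σ * affSwap N i (i + 1) = affSwap N i (i + 1) * σ
  · rw [richardsonSpringer_of_comm h]
    exact hσ.mul isPeriodicPerm_affSwap
  · rw [richardsonSpringer_of_not_comm h]
    exact (isPeriodicPerm_affSwap.mul hσ).mul isPeriodicPerm_affSwap

theorem richardsonSpringer_inv (hi : σ⁻¹ = σ) :
    (richardsonSpringer N i σ)⁻¹ = richardsonSpringer N i σ := by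
  by_cases h : σ * affSwap N i (i + 1) = affSwap N i (i + 1) * σ
  · rw [richardsonSpringer_of_comm h, mul_inv_rev, affSwap_inv, hi, h]
  · rw [richardsonSpringer_of_not_comm h, mul_inv_rev, mul_inv_rev, affSwap_inv, hi, mul_assoc]

theorem richardsonSpringer_richardsonSpringer :
    richardsonSpringer N i (richardsonSpringer N i σ) = σ := by
  by_cases h : σ * affSwap N i (i + 1) = affSwap N i (i + 1) * σ
  · rw [richardsonSpringer_of_comm h, richardsonSpringer_of_comm]
    · simp [mul_assoc]
    · rw [← mul_assoc, ← h]
  · rw [richardsonSpringer_of_not_comm h, richardsonSpringer_of_not_comm]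
    · simp only [← mul_assoc]
      simp [mul_assoc]
    · simp only [← mul_assoc]
      simp only [affSwap_mul_self, one_mul]
      rw [mul_assoc, affSwap_mul_self, mul_one]
      exact fun e => h e.symm

theorem apply_apply_of_inv_eq (hi : σ⁻¹ = σ) (x : ℤ) : σ (σ x) = x := by
  have := mul_eq_one_iff_inv_eq.2 hi
  rw [← Equiv.Perm.mul_apply, this, Equiv.Perm.one_apply]

/-- Commutation and the ascent force `σ` to shift `i` and `i + 1` by the same multiple of `N`; an
involution can only do so with shift zero. -/
theorem comm_iff (hd : ¬ (N : ℤ) ∣ i + 1 - i) (hσ : IsPeriodicPerm N σ)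
    (hi : σ⁻¹ = σ) (h : σ i < σ (i + 1)) :
    σ * affSwap N i (i + 1) = affSwap N i (i + 1) * σ ↔ σ i = i ∧ σ (i + 1) = i + 1 := by
  have hσσ := apply_apply_of_inv_eq hi
  constructor
  · intro e
    have e1 := congrArg (fun g : Equiv.Perm ℤ => g i) e
    simp only [Equiv.Perm.mul_apply, affSwap_apply_left hd] at e1
    have key : ∃ m : ℤ, σ i = i + m * N ∧ σ (i + 1) = i + 1 + m * N := by
      rcases affSwap_cases hd (σ i) with ⟨k, h3, h4⟩ | ⟨k, h3, h4⟩ | ⟨h4, _⟩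
      · exact ⟨k, h3, e1.trans h4⟩
      · rw [h4] at e1
        omega
      · rw [h4] at e1
        omega
    obtain ⟨m, h1, h2⟩ := key
    have := hσσ i
    rw [h1, hσ.add_mul, h1] at this
    have hm : m * N = 0 := by linarith
    rw [hm] at h1 h2
    exact ⟨by simpa using h1, by simpa using h2⟩
  · rintro ⟨h1, h2⟩
    have := mul_affSwap hσ hd
    rwa [h1, h2] at this

theorem affSwap_lt_of_not_comm (hd : ¬ (N : ℤ) ∣ i + 1 - i) (hσ : IsPeriodicPerm N σ)
    (hc : ¬ σ * affSwap N i (i + 1) = affSwap N i (i + 1) * σ) (h : σ i < σ (i + 1)) :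
    affSwap N i (i + 1) (σ i) < affSwap N i (i + 1) (σ (i + 1)) := by
  rcases affSwap_succ_lt hd h with h' | ⟨m, h1, h2⟩
  · exact h'
  · refine absurd ?_ hc
    rw [mul_affSwap hσ hd, h1, h2, affSwap_add_mul hd]

theorem affSwap_lt_of_not_comm' (hd : ¬ (N : ℤ) ∣ i + 1 - i) (hσ : IsPeriodicPerm N σ)
    (hc : ¬ σ * affSwap N i (i + 1) = affSwap N i (i + 1) * σ) (h : σ (i + 1) < σ i) :
    affSwap N i (i + 1) (σ (i + 1)) < affSwap N i (i + 1) (σ i) := by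
  rcases affSwap_succ_lt hd h with h' | ⟨m, h1, h2⟩
  · exact h'
  · refine absurd ?_ hc
    rw [mul_affSwap hσ hd, affSwap_comm (a := σ i), h1, h2, affSwap_add_mul hd]

/-- After the right multiplication, the left one acts only if `s` and `σ` do not commute: in the
commuting case `s σ = σ s` already has a descent at `i`. Hence the action inherits the monotonicity
of `biUp`. -/
theorem biUp_of_lt (hd : ¬ (N : ℤ) ∣ i + 1 - i) (hσ : IsPeriodicPerm N σ)
    (hi : σ⁻¹ = σ) (h : σ i < σ (i + 1)) : biUp N i σ = richardsonSpringer N i σ := by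
  rw [biUp, rightUp.eq_1 N i σ, if_pos h, mul_inv_rev, affSwap_inv, hi, rightUp]
  by_cases hc : σ * affSwap N i (i + 1) = affSwap N i (i + 1) * σ
  · rw [richardsonSpringer_of_comm hc, if_neg, ← hc, mul_inv_rev, affSwap_inv, hi, hc]
    rw [← hc]
    simp only [Equiv.Perm.mul_apply, affSwap_apply_left hd, affSwap_apply_right hd]
    omega
  · rw [richardsonSpringer_of_not_comm hc]
    rw [if_pos (by exact affSwap_lt_of_not_comm hd hσ hc h)]
    simp only [mul_inv_rev, affSwap_inv, hi, mul_assoc]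

theorem biUp_of_not_lt (hi : σ⁻¹ = σ) (h : ¬ σ i < σ (i + 1)) : biUp N i σ = σ := by
  rw [biUp, rightUp.eq_1 N i σ, if_neg h, hi, rightUp, if_neg h, hi]

theorem biDown_of_lt (hi : σ⁻¹ = σ) (h : σ i < σ (i + 1)) : biDown N i σ = σ := by
  rw [biDown, rightDown.eq_1 N i σ, if_pos h, hi, rightDown, if_pos h, hi]

theorem biDown_of_not_lt (hd : ¬ (N : ℤ) ∣ i + 1 - i) (hσ : IsPeriodicPerm N σ)
    (hi : σ⁻¹ = σ) (h : ¬ σ i < σ (i + 1)) : biDown N i σ = richardsonSpringer N i σ := by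
  have hne : σ i ≠ σ (i + 1) := fun e => by have := σ.injective e; omega
  rw [biDown, rightDown.eq_1 N i σ, if_neg h, mul_inv_rev, affSwap_inv, hi, rightDown]
  by_cases hc : σ * affSwap N i (i + 1) = affSwap N i (i + 1) * σ
  · rw [richardsonSpringer_of_comm hc, if_pos, ← hc, mul_inv_rev, affSwap_inv, hi, hc]
    rw [← hc]
    simp only [Equiv.Perm.mul_apply, affSwap_apply_left hd, affSwap_apply_right hd]
    omega
  · rw [richardsonSpringer_of_not_comm hc, if_neg]
    · simp only [mul_inv_rev, affSwap_inv, hi, mul_assoc]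
    · have := affSwap_lt_of_not_comm' hd hσ hc (by omega)
      simp only [Equiv.Perm.mul_apply]
      omega

theorem richardsonSpringer_lt_iff (hd : ¬ (N : ℤ) ∣ i + 1 - i) (hσ : IsPeriodicPerm N σ) :
    richardsonSpringer N i σ i < richardsonSpringer N i σ (i + 1) ↔ ¬ σ i < σ (i + 1) := by
  have hne : σ i ≠ σ (i + 1) := fun e => by have := σ.injective e; omega
  by_cases hc : σ * affSwap N i (i + 1) = affSwap N i (i + 1) * σ
  · rw [richardsonSpringer_of_comm hc]
    simp only [Equiv.Perm.mul_apply, affSwap_apply_left hd, affSwap_apply_right hd]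
    omega
  · rw [richardsonSpringer_of_not_comm hc]
    simp only [Equiv.Perm.mul_apply, affSwap_apply_left hd, affSwap_apply_right hd]
    constructor
    · intro h h'
      have := affSwap_lt_of_not_comm hd hσ hc h'
      omega
    · intro h
      exact affSwap_lt_of_not_comm' hd hσ hc (by omega)

end involution

/-! ### The rank of an involution. -/

/-- The two-cycles of an involution. -/
def cycleSet (σ : Equiv.Perm ℤ) : Set (ℤ × ℤ) := {p | p.1 < p.2 ∧ σ p.1 = p.2}

/-- Representatives of the pairs `{(x, y), (σ y, σ x)}` of inversions of an involution `σ`. -/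
def symmInvSet (σ : Equiv.Perm ℤ) : Set (ℤ × ℤ) :=
  {p | p.1 < p.2 ∧ p.1 ≤ σ p.2 ∧ σ p.2 < σ p.1}

/-- The number of pairs `{(x, y), (σ y, σ x)}` of inversions of an involution, modulo the
period. -/
noncomputable def involutionRank (N : ℕ) (σ : Equiv.Perm ℤ) : ℕ := orbitCount N (symmInvSet σ)

section rank

variable {N : ℕ} {σ : Equiv.Perm ℤ} {i : ℤ}

theorem cycleSet_subset (hi : σ⁻¹ = σ) : cycleSet σ ⊆ invSet σ := by
  rintro ⟨x, y⟩ ⟨h1, h2⟩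
  simp only at h1 h2
  subst h2
  exact ⟨h1, by simpa only [apply_apply_of_inv_eq hi] using h1⟩

theorem IsPeriodicPerm.shiftPair_mem_cycleSet (hσ : IsPeriodicPerm N σ) :
    ∀ p ∈ cycleSet σ, ∀ m, shiftPair N m p ∈ cycleSet σ := by
  rintro ⟨x, y⟩ ⟨h1, h2⟩ m
  simp only [shiftPair, cycleSet, Set.mem_ofPred_eq, hσ.add_mul] at *
  constructor <;> linarith

theorem IsPeriodicPerm.shiftPair_mem_symmInvSet (hσ : IsPeriodicPerm N σ) :
    ∀ p ∈ symmInvSet σ, ∀ m, shiftPair N m p ∈ symmInvSet σ := by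
  rintro ⟨x, y⟩ ⟨h1, h2, h3⟩ m
  simp only [shiftPair, symmInvSet, Set.mem_ofPred_eq, hσ.add_mul] at *
  refine ⟨?_, ?_, ?_⟩ <;> linarith

/-- The mirror `(x, y) ↦ (σ y, σ x)` exchanges the inversions with `x < σ y` (`U`) and those with `σ
y < x` (`V`); the remaining ones, with `x = σ y`, are the two-cycles and are counted once. -/
theorem two_mul_involutionRank (hN : 0 < N) (hσ : IsPeriodicPerm N σ) (hi : σ⁻¹ = σ) :
    2 * involutionRank N σ = affLength N σ + orbitCount N (cycleSet σ) := by
  have hσσ := apply_apply_of_inv_eq hi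
  obtain ⟨C, hC⟩ := hσ.invSet_bound hN
  set U : Set (ℤ × ℤ) := {p | p.1 < p.2 ∧ p.1 < σ p.2 ∧ σ p.2 < σ p.1} with hU
  set V : Set (ℤ × ℤ) := {p | p.1 < p.2 ∧ σ p.2 < p.1 ∧ σ p.2 < σ p.1} with hV
  have hUV : orbitCount N U = orbitCount N V := by
    rw [← orbitCount_image hN (φ := fun p => (σ p.2, σ p.1)) (S := U)]
    · congr 1
      ext ⟨x, y⟩
      simp only [Set.mem_image, hU, hV, Set.mem_ofPred_eq, Prod.mk.injEq, Prod.exists]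
      constructor
      · rintro ⟨a, b, ⟨h1, h2, h3⟩, rfl, rfl⟩
        rw [hσσ, hσσ]
        exact ⟨h3, h2, h1⟩
      · rintro ⟨h1, h2, h3⟩
        exact ⟨σ y, σ x, by rw [hσσ, hσσ]; exact ⟨⟨h3, h2, h1⟩, rfl, rfl⟩⟩
    · rintro ⟨x, y⟩ _ ⟨x', y'⟩ _ h
      simp only [Prod.mk.injEq, EmbeddingLike.apply_eq_iff_eq] at h
      ext
      · exact h.2
      · exact h.1
    · rintro ⟨x, y⟩ ⟨h1, h2, h3⟩ m
      simp only [shiftPair, hU, Set.mem_ofPred_eq, hσ.add_mul] at *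
      refine ⟨?_, ?_, ?_⟩ <;> linarith
    · intro p _ m
      simp [shiftPair, hσ.add_mul]
  have h1 : symmInvSet σ = U ∪ cycleSet σ := by
    ext ⟨x, y⟩
    simp only [symmInvSet, hU, cycleSet, Set.mem_union, Set.mem_ofPred_eq]
    constructor
    · rintro ⟨h1, h2, h3⟩
      rcases h2.lt_or_eq with h | h
      · exact Or.inl ⟨h1, h, h3⟩
      · exact Or.inr ⟨h1, by rw [h, hσσ]⟩
    · rintro (⟨h1, h2, h3⟩ | ⟨h1, rfl⟩)
      · exact ⟨h1, h2.le, h3⟩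
      · rw [hσσ]
        exact ⟨h1, le_rfl, h1⟩
  have h2 : invSet σ = symmInvSet σ ∪ V := by
    ext ⟨x, y⟩
    simp only [symmInvSet, hV, invSet, Set.mem_union, Set.mem_ofPred_eq]
    have := le_or_gt x (σ y)
    tauto
  have hUC : ∀ p ∈ U, |p.2 - p.1| ≤ C := fun p hp => hC p ⟨hp.1, hp.2.2⟩
  have hVC : ∀ p ∈ V, |p.2 - p.1| ≤ C := fun p hp => hC p ⟨hp.1, hp.2.2⟩
  have e1 : involutionRank N σ = orbitCount N U + orbitCount N (cycleSet σ) := by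
    rw [involutionRank, h1, orbitCount_union hUC fun p hp => hC p (cycleSet_subset hi hp)]
    rintro ⟨x, y⟩ ⟨_, h, _⟩ ⟨_, h'⟩
    simp only at h h'
    rw [← h', hσσ] at h
    exact lt_irrefl _ h
  have e2 : affLength N σ = involutionRank N σ + orbitCount N V := by
    rw [affLength, h2, orbitCount_union _ hVC, involutionRank]
    · rintro ⟨x, y⟩ ⟨_, h, _⟩ ⟨_, h', _⟩
      exact absurd h (not_le.2 h')
    · exact fun p hp => hC p ⟨hp.1, hp.2.2⟩
  omega

/-- If `s` commutes with `σ`, the length grows by one and one orbit of two-cycles is created;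
otherwise the length grows by two and conjugation carries two-cycles to two-cycles. -/
theorem involutionRank_richardsonSpringer_of_lt (hN : 0 < N) (hd : ¬ (N : ℤ) ∣ i + 1 - i)
    (hσ : IsPeriodicPerm N σ) (hi : σ⁻¹ = σ) (h : σ i < σ (i + 1)) :
    involutionRank N (richardsonSpringer N i σ) = involutionRank N σ + 1 := by
  have hσσ := apply_apply_of_inv_eq hi
  have r1 := two_mul_involutionRank hN hσ hi
  have r2 := two_mul_involutionRank hN (richardsonSpringer_isPeriodic (i := i) hσ)
    (richardsonSpringer_inv hi)
  have hl := affLength_mul_succ hN hd hσ h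
  obtain ⟨C, hC⟩ := hσ.invSet_bound hN
  by_cases hc : σ * affSwap N i (i + 1) = affSwap N i (i + 1) * σ
  · rw [richardsonSpringer_of_comm hc] at *
    obtain ⟨hf1, hf2⟩ := (comm_iff hd hσ hi h).1 hc
    have : cycleSet (σ * affSwap N i (i + 1)) =
        cycleSet σ ∪ Set.range fun m => shiftPair N m (i, i + 1) := by
      ext ⟨x, y⟩
      simp only [cycleSet, Set.mem_ofPred_eq, Set.mem_union, Set.mem_range, shiftPair,
        Prod.mk.injEq, Equiv.Perm.mul_apply]
      rcases affSwap_cases hd x with ⟨k, h3, h4⟩ | ⟨k, h3, h4⟩ | ⟨h4, h5, _⟩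
      · rw [h4, h3, hσ.add_mul, hσ.add_mul, hf1, hf2]
        constructor
        · rintro ⟨_, h⟩
          exact Or.inr ⟨k, rfl, h⟩
        · rintro (⟨h1, h2⟩ | ⟨m, h1, h2⟩)
          · omega
          · omega
      · rw [h4, h3, hσ.add_mul, hσ.add_mul, hf1, hf2]
        constructor
        · rintro ⟨h1, h2⟩
          omega
        · rintro (⟨h1, h2⟩ | ⟨m, h1, h2⟩)
          · omega
          · exact absurd (int_dvd_sub_iff.2 ⟨m - k, by linarith⟩) hd
      · rw [h4]
        constructor
        · exact Or.inl
        · rintro (h | ⟨m, h1, _⟩)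
          · exact h
          · exact absurd (int_dvd_sub_iff.2 ⟨m, h1.symm⟩) h5
    have e : orbitCount N (cycleSet (σ * affSwap N i (i + 1))) =
        orbitCount N (cycleSet σ) + 1 := by
      rw [this, orbitCount_union (C := max C |i + 1 - i|), orbitCount_orbit hN]
      · exact fun p hp => (hC p (cycleSet_subset hi hp)).trans (le_max_left _ _)
      · exact fun p hp => (orbit_bound p hp).trans (le_max_right _ _)
      · rintro _ ⟨_, h2⟩ ⟨m, rfl⟩
        simp only [shiftPair, hσ.add_mul, hf1] at h2
        omega
    omega
  · have hlt := affSwap_lt_of_not_comm hd hσ hc h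
    have hl2 : affLength N (affSwap N i (i + 1) * σ * affSwap N i (i + 1)) =
        affLength N σ + 2 := by
      have hp := isPeriodicPerm_affSwap (N := N) (a := i) (b := i + 1)
      rw [affLength_mul_succ hN hd (hp.mul hσ) hlt]
      have := affLength_inv hN (hσ.mul hp)
      rw [mul_inv_rev, affSwap_inv, hi] at this
      omega
    have e : orbitCount N (cycleSet (affSwap N i (i + 1) * σ * affSwap N i (i + 1))) =
        orbitCount N (cycleSet σ) := by
      rw [← orbitCount_image hN (φ := Prod.map (affSwap N i (i + 1)) (affSwap N i (i + 1))) _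
        hσ.shiftPair_mem_cycleSet]
      · congr 1
        ext ⟨x, y⟩
        constructor
        · rintro ⟨h1, h2⟩
          simp only [Equiv.Perm.mul_apply] at h1 h2
          refine ⟨(affSwap N i (i + 1) x, affSwap N i (i + 1) y), ⟨?_, ?_⟩, by simp⟩
          · rcases affSwap_succ_lt hd h1 with h | ⟨m, rfl, rfl⟩
            · exact h
            · have h3 := congrArg (affSwap N i (i + 1)) h2
              rw [affSwap_left hd, affSwap_affSwap, affSwap_right hd, hσ.add_mul] at h3
              have h4 : σ (i + 1) = i := by linarith
              have h5 := hσσ (i + 1)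
              rw [h4] at h5
              omega
          · simp [← h2]
        · rintro ⟨⟨x', y'⟩, ⟨h1, h2⟩, h3⟩
          simp only [Prod.map_apply, Prod.mk.injEq] at h1 h2 h3
          rw [← h3.1, ← h3.2]
          refine ⟨?_, by simp [h2]⟩
          rcases affSwap_succ_lt hd h1 with h | ⟨m, rfl, rfl⟩
          · exact h
          · rw [hσ.add_mul] at h2
            have h4 : σ i = i + 1 := by linarith
            have h5 := hσσ i
            rw [h4] at h5
            omega
      · intro p _ m
        simp [shiftPair, isPeriodicPerm_affSwap.add_mul]
      · exact (Prod.map_injective.2 ⟨(affSwap N i (i + 1)).injective,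
          (affSwap N i (i + 1)).injective⟩).injOn
    rw [richardsonSpringer_of_not_comm hc] at *
    omega

end rank

/-! ### The Bruhat order on involutions is graded. -/

section grading

variable {N : ℕ} {u w σ : Equiv.Perm ℤ} {i : ℤ}

theorem involutionRank_richardsonSpringer_of_not_lt (hN : 0 < N) (hd : ¬ (N : ℤ) ∣ i + 1 - i)
    (hσ : IsPeriodicPerm N σ) (hi : σ⁻¹ = σ) (h : ¬ σ i < σ (i + 1)) :
    involutionRank N σ = involutionRank N (richardsonSpringer N i σ) + 1 := by
  have := involutionRank_richardsonSpringer_of_lt hN hd (richardsonSpringer_isPeriodic hσ)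
    (richardsonSpringer_inv hi) ((richardsonSpringer_lt_iff hd hσ).2 h)
  rwa [richardsonSpringer_richardsonSpringer] at this

/-- Without descents `w` is increasing, but the last edge of a nontrivial chain up to `w` creates an
inversion. -/
theorem PermLE.exists_not_lt_succ (h : PermLE N u w) (hne : u ≠ w) :
    ∃ i, ¬ w i < w (i + 1) := by
  by_contra! hc
  have hm := strictMono_int_of_lt_succ hc
  rcases h.cases_tail with h | ⟨c, _, a, b, hd, hab, hlt, e⟩
  · exact hne h.symm
  · have := hm hab
    rw [e] at this
    simp only [Equiv.Perm.mul_apply, affSwap_apply_left hd, affSwap_apply_right hd] at this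
    omega

/-- The restriction of the Bruhat order to involutions is graded by `involutionRank`. -/
theorem PermLE.involutionRank_lt_and_exists (hN : 2 ≤ N) :
    ∀ (k : ℕ) (u w : Equiv.Perm ℤ), involutionRank N w ≤ k → IsPeriodicPerm N u → u⁻¹ = u →
      w⁻¹ = w → PermLE N u w → u ≠ w →
      involutionRank N u < involutionRank N w ∧
        ∃ v : Equiv.Perm ℤ, v⁻¹ = v ∧ PermLE N u v ∧ PermLE N v w ∧
          involutionRank N v = involutionRank N u + 1 := by
  have hN0 : 0 < N := by omega
  intro k
  induction k with
  | zero =>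
    intro u w hk hu hui hwi huw hne
    obtain ⟨i, hw⟩ := huw.exists_not_lt_succ hne
    have hd : ¬ (N : ℤ) ∣ i + 1 - i := fun h => by
      have := Int.le_of_dvd (by omega) h
      omega
    have := involutionRank_richardsonSpringer_of_not_lt hN0 hd (huw.isPeriodicPerm hu) hwi hw
    omega
  | succ k ih =>
    intro u w hk hu hui hwi huw hne
    obtain ⟨i, hw⟩ := huw.exists_not_lt_succ hne
    have hd : ¬ (N : ℤ) ∣ i + 1 - i := fun h => by
      have := Int.le_of_dvd (by omega) h
      omega
    have hwp := huw.isPeriodicPerm hu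
    have hrw := involutionRank_richardsonSpringer_of_not_lt hN0 hd hwp hwi hw
    have hup := huw.biUp hd hu
    have hdown := huw.biDown hd hu
    rw [biUp_of_not_lt hwi hw] at hup
    rw [biDown_of_not_lt hd hwp hwi hw] at hdown
    -- If `u` ascends at the descent `i` of `w`, the action on `u` already yields the required
    -- element below `w`. Otherwise both are lowered, the induction hypothesis is applied, and its
    -- element `v` is raised again.
    by_cases hu' : u i < u (i + 1)
    · rw [biUp_of_lt hd hu hui hu'] at hup
      rw [biDown_of_lt hui hu'] at hdown
      have hru := involutionRank_richardsonSpringer_of_lt hN0 hd hu hui hu'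
      refine ⟨?_, richardsonSpringer N i u, richardsonSpringer_inv hui, ?_, hup, hru⟩
      · by_cases he : u = richardsonSpringer N i w
        · rw [hrw, he]; omega
        · have := (ih u _ (by omega) hu hui (richardsonSpringer_inv hwi) hdown he).1
          omega
      · rw [← biUp_of_lt hd hu hui hu']
        exact le_biUp hd hu
    · rw [biDown_of_not_lt hd hu hui hu'] at hdown
      have hru := involutionRank_richardsonSpringer_of_not_lt hN0 hd hu hui hu'
      have hu1 := richardsonSpringer_isPeriodic (i := i) hu
      have hu2 := richardsonSpringer_inv (N := N) (i := i) hui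
      have hu3 := (richardsonSpringer_lt_iff hd hu).2 hu'
      have hw1 := richardsonSpringer_isPeriodic (i := i) hwp
      have hw2 := richardsonSpringer_inv (N := N) (i := i) hwi
      have hw3 := (richardsonSpringer_lt_iff hd hwp).2 hw
      have hne' : richardsonSpringer N i u ≠ richardsonSpringer N i w := fun e => hne (by
        rw [← richardsonSpringer_richardsonSpringer (N := N) (i := i) (σ := u), e,
          richardsonSpringer_richardsonSpringer])
      obtain ⟨hlt, v, hvi, huv, hvw, hv⟩ := ih _ _ (by omega) hu1 hu2 hw2 hdown hne'
      have hvp := huv.isPeriodicPerm hu1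
      refine ⟨by omega, ?_⟩
      have h1 := huv.biUp hd hu1
      rw [biUp_of_lt hd hu1 hu2 hu3, richardsonSpringer_richardsonSpringer] at h1
      have h2 := hvw.biUp hd hvp
      rw [biUp_of_lt hd hw1 hw2 hw3, richardsonSpringer_richardsonSpringer] at h2
      have h3 := le_biUp hd hw1
      rw [biUp_of_lt hd hw1 hw2 hw3, richardsonSpringer_richardsonSpringer] at h3
      by_cases hv' : v i < v (i + 1)
      · rw [biUp_of_lt hd hvp hvi hv'] at h1 h2
        refine ⟨_, richardsonSpringer_inv hvi, h1, h2, ?_⟩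
        rw [involutionRank_richardsonSpringer_of_lt hN0 hd hvp hvi hv']
        omega
      · rw [biUp_of_not_lt hvi hv'] at h1
        -- Here `v` already descends at `i`, so `u ≤ v`; the two ranks agree, which forces equality.
        -- Thus `u` lies below the lowered `w`, and the induction hypothesis applies to that pair
        -- unless they coincide.
        have huv' : u = v := by
          by_contra hcon
          by_cases hvw' : involutionRank N v ≤ k
          · have := (ih u v hvw' hu hui hvi h1 hcon).1
            omega
          · omega
        subst huv'
        by_cases he : u = richardsonSpringer N i w
        · exact ⟨w, hwi, huw, .refl, by rw [he]; exact hrw⟩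
        · obtain ⟨-, x, hx, hx1, hx2, hx3⟩ := ih _ _ (by omega) hu hui hw2 hvw he
          exact ⟨x, hx, hx1, hx2.trans h3, hx3⟩

end grading

/-! ### Maximal bounded involutions. -/

section bounded

variable {N n : ℕ} {σ : Equiv.Perm ℤ}

/-- The points `x` with `|σ x - x| < n`, for an involution `σ` with `|σ x - x| ≤ n` of period
`2n`, are permuted by the translation by `n`. -/
theorem abs_sub_lt_add (hN : (N : ℤ) = 2 * n) (hσ : IsPeriodicPerm N σ) (hi : σ⁻¹ = σ)
    (hb : ∀ x, |σ x - x| ≤ n) {x : ℤ} (hx : |σ x - x| < n) : |σ (x + n) - (x + n)| < n := by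
  have hσσ := apply_apply_of_inv_eq hi
  refine lt_of_le_of_ne (hb _) fun h => ?_
  rw [abs_lt] at hx
  rcases eq_or_eq_neg_of_abs_eq h with h | h
  · have h1 : σ (x + n) = x + N := by linarith
    have h2 := hσσ (x + n)
    rw [h1, hσ] at h2
    linarith
  · have h1 : σ (x + n) = x := by linarith
    have h2 := hσσ (x + n)
    rw [h1] at h2
    linarith

theorem abs_sub_lt_add_mul (hσ : IsPeriodicPerm N σ) {x : ℤ} (m : ℤ)
    (hx : |σ x - x| < n) : |σ (x + m * N) - (x + m * N)| < n := by
  rw [hσ.add_mul]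
  simpa using hx

theorem permLE_conj (hσ : IsPeriodicPerm N σ) (hi : σ⁻¹ = σ) {a b : ℤ}
    (hd : ¬ (N : ℤ) ∣ b - a) (hab : a < b)
    (h' : affSwap N a b (σ a) < affSwap N a b (σ b)) :
    PermLE N (σ * affSwap N a b) (affSwap N a b * σ * affSwap N a b) := by
  have h1 : PermStep N (affSwap N a b * σ) (affSwap N a b * σ * affSwap N a b) :=
    ⟨a, b, hd, hab, h', rfl⟩
  have h2 := h1.inv (isPeriodicPerm_affSwap.mul hσ)
  simp only [mul_inv_rev, affSwap_inv, hi, ← mul_assoc] at h2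
  exact .single h2

/-- Let `E` be the set of points moved by less than `n`; it is stable under `σ` and under
translation by `n`. Choose `a < b` in `E` with `σ a < σ b` and `b - a` minimal. Then `a` and `b` are
consecutive in `E`, so swapping them cannot jump over other points of `E`, which keeps the bound.
The new involution is the conjugate of `σ` by the swap, or, when `a` and `b` turn out to be fixed
points, `σ` with the two-cycles through `a` and `b` added. -/
theorem exists_larger_involution (hN : (N : ℤ) = 2 * n) (hσ : IsPeriodicPerm N σ) (hi : σ⁻¹ = σ)
    (hb : ∀ x, |σ x - x| ≤ n) (hx : ∃ x, |σ x - x| < n) :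
    ∃ w : Equiv.Perm ℤ, w⁻¹ = w ∧ PermLE N σ w ∧ σ ≠ w ∧ ∀ x, |w x - x| ≤ n := by
  classical
  have hσσ := apply_apply_of_inv_eq hi
  have hn : 0 < (n : ℤ) := by
    obtain ⟨x, hx⟩ := hx
    exact (abs_nonneg _).trans_lt hx
  have hEσ : ∀ x, |σ x - x| < n ↔ |σ (σ x) - σ x| < n := fun x => by
    rw [hσσ, abs_sub_comm]
  have hEm : ∀ x m : ℤ, |σ x - x| < n → |σ (x + m * N) - (x + m * N)| < n :=
    fun x m => abs_sub_lt_add_mul hσ m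
  have hEn : ∀ x : ℤ, |σ x - x| < n → |σ (x + n) - (x + n)| < n :=
    fun x => abs_sub_lt_add hN hσ hi hb
  have hex : ∃ d : ℕ, 0 < d ∧ ∃ a : ℤ, |σ a - a| < n ∧ |σ (a + d) - (a + d)| < n ∧
      σ a < σ (a + d) := by
    obtain ⟨x, hx⟩ := hx
    refine ⟨N, by omega, x, hx, by simpa using hEm x 1 hx, ?_⟩
    rw [hσ]
    omega
  obtain ⟨hd0, a, ha, hb', hσab⟩ := Nat.find_spec hex
  have hmin : ∀ d' : ℕ, d' < Nat.find hex → _ := fun d' h => Nat.find_min hex h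
  generalize Nat.find hex = d at *
  obtain ⟨b, hbd⟩ : ∃ b, b = a + (d : ℤ) := ⟨_, rfl⟩
  rw [← hbd] at hb' hσab
  have hab : a < b := by omega
  -- Any `c` in `E` strictly between would give a closer pair, `(a, c)` or `(c, b)`, according to
  -- whether `σ a < σ c`.
  have hcons : ∀ c, |σ c - c| < n → a < c → c < b → False := by
    intro c hc h1 h2
    rcases lt_or_ge (σ a) (σ c) with h | h
    · refine hmin (c - a).toNat (by omega) ⟨by omega, a, ha, ?_, ?_⟩
      · rwa [show a + ((c - a).toNat : ℤ) = c by omega]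
      · rwa [show a + ((c - a).toNat : ℤ) = c by omega]
    · refine hmin (b - c).toNat (by omega) ⟨by omega, c, hc, ?_, ?_⟩
      · rwa [show c + ((b - c).toNat : ℤ) = b by omega]
      · rw [show c + ((b - c).toNat : ℤ) = b by omega]
        omega
  have hbn : b ≤ a + n := by
    by_contra! h
    exact hcons (a + n) (hEn a ha) (by omega) h
  have hdvd : ¬ (N : ℤ) ∣ b - a := fun h => by
    have := Int.le_of_dvd (by omega) h
    omega
  have hcm : ∀ c m : ℤ, |σ c - c| < n → a + m * N < c → b + m * N ≤ c := by
    intro c m hc h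
    by_contra! h'
    refine hcons _ (hEm c (-m) hc) ?_ ?_ <;> linarith
  have hcn : ∀ c m : ℤ, |σ c - c| < n → c < b + n + m * N → c ≤ a + n + m * N := by
    intro c m hc h
    by_contra! h'
    refine hcons _ (hEm _ (-m - 1) (hEn c hc)) ?_ ?_ <;>
    · rw [hN] at *; linarith
  have hEa : ∀ m : ℤ, |σ (a + m * N) - (a + m * N)| < n := fun m => hEm a m ha
  have hEb : ∀ m : ℤ, |σ (b + m * N) - (b + m * N)| < n := fun m => hEm b m hb'
  have hstep : PermStep N σ (σ * affSwap N a b) := ⟨a, b, hdvd, hab, hσab, rfl⟩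
  -- For an involution the lower bound is the upper bound applied at `w x`.
  have hupper : ∀ w : Equiv.Perm ℤ, w⁻¹ = w → (∀ x, w x ≤ x + n) → ∀ x, |w x - x| ≤ n := by
    intro w hw h x
    have h1 := h x
    have h2 := h (w x)
    rw [apply_apply_of_inv_eq hw] at h2
    rw [abs_le]
    constructor <;> linarith
  have hne : ∀ w, PermLE N (σ * affSwap N a b) w → σ ≠ w := by
    rintro w h rfl
    have h1 := PermLE.antisymm (by omega) hσ (.single hstep) h
    have h2 := congrArg (fun g : Equiv.Perm ℤ => g a) h1
    simp only [Equiv.Perm.mul_apply, affSwap_apply_left hdvd] at h2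
    omega
  have hbu : ∀ x, σ x ≤ x + n := fun x => by
    have := abs_le.1 (hb x)
    linarith
  by_cases ht : affSwap N a b (σ a) < affSwap N a b (σ b)
  · have hle := permLE_conj hσ hi hdvd hab ht
    have hw : (affSwap N a b * σ * affSwap N a b)⁻¹ = affSwap N a b * σ * affSwap N a b := by
      simp only [mul_inv_rev, affSwap_inv, hi, mul_assoc]
    refine ⟨_, hw, .head hstep hle, hne _ hle, hupper _ hw fun x => ?_⟩
    suffices H : ∀ z, affSwap N a b (σ z) ≤ affSwap N a b z + n by
      simpa using H (affSwap N a b x)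
    intro z
    have fixE : ∀ y, ¬ |σ y - y| < n → affSwap N a b y = y := by
      intro y hy
      rcases affSwap_cases hdvd y with ⟨k, rfl, _⟩ | ⟨k, rfl, _⟩ | ⟨h, _⟩
      · exact absurd (hEa k) hy
      · exact absurd (hEb k) hy
      · exact h
    by_cases hz : |σ z - z| < n
    · have hσz : σ z < z + n := by
        have := abs_lt.1 hz
        linarith
      have hσz' := (hEσ z).1 hz
      rcases affSwap_cases hdvd z with ⟨k, h1, h2⟩ | ⟨k, h1, h2⟩ | ⟨h2, h2', _⟩ <;>
      rcases affSwap_cases hdvd (σ z) with ⟨l, h3, h4⟩ | ⟨l, h3, h4⟩ | ⟨h4, _, _⟩ <;>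
      rw [h2, h4]
      · linarith
      · linarith
      · linarith
      · have h5 := hcn _ k hσz' (by linarith)
        rcases h5.lt_or_eq with h5 | h5
        · have := hcm (a + n + k * N)  l (by
            have := hEn _ (hEa k)
            rwa [show a + n + k * N = a + k * N + n by ring]) (by linarith)
          linarith
        -- Equality would make `n` a multiple of `2n`.
        · exfalso
          have h6 : (n : ℤ) * 1 = n * (2 * (l - k)) := by
            rw [hN] at *
            linarith
          have := mul_left_cancel₀ hn.ne' h6
          omega
      · linarith
      · have := hcn _ k hσz' (by linarith)
        linarith
      · have := hcm (z + n) l (hEn z hz) (by linarith)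
        linarith
      · linarith
      · linarith
    · rw [fixE z hz, fixE (σ z) (fun h => hz ((hEσ z).2 h))]
      exact hbu z
  -- The swap can reverse `σ a < σ b` only if these form a translate of `(a, b)`, since `σ a` and `σ
  -- b` lie in `E` too. The involution property then makes the shift zero.
  · have key : ∃ m : ℤ, σ a = a + m * N ∧ σ b = b + m * N := by
      have ha' := (hEσ a).1 ha
      have hb'' := (hEσ b).1 hb'
      by_contra! hk
      apply ht
      rcases affSwap_cases hdvd (σ a) with ⟨k, h1, h2⟩ | ⟨k, h1, h2⟩ | ⟨h2, h2', h2''⟩ <;>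
      rcases affSwap_cases hdvd (σ b) with ⟨l, h3, h4⟩ | ⟨l, h3, h4⟩ | ⟨h4, h4', h4''⟩ <;>
      rw [h2, h4]
      · linarith
      · have h5 := hcm _ k hb'' (by linarith)
        have h6 : k * N < l * N := by
          refine lt_of_le_of_ne (by linarith) fun e => hk k h1 ?_
          rw [h3, e]
        have h7 := lt_of_mul_lt_mul_right h6 (by omega)
        have h8 : (k + 1) * (N : ℤ) ≤ l * N :=
          mul_le_mul_of_nonneg_right (by omega) (by omega)
        linarith
      · have h5 := hcm _ k hb'' (by linarith)
        refine lt_of_le_of_ne h5 fun e => h4'' (int_dvd_sub_iff.2 ⟨k, e.symm⟩)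
      · linarith
      · linarith
      · linarith
      · linarith
      · by_contra! h5
        rcases h5.lt_or_eq with h5 | h5
        · have := hcm _ l ha' h5
          linarith
        · exact h2' (int_dvd_sub_iff.2 ⟨l, h5.symm⟩)
      · exact hσab
    obtain ⟨m, h1, h2⟩ := key
    have h3 := hσσ a
    rw [h1, hσ.add_mul, h1] at h3
    have hm : m * (N : ℤ) = 0 := by linarith
    rw [hm, add_zero] at h1 h2
    have hw : (σ * affSwap N a b)⁻¹ = σ * affSwap N a b := by
      rw [mul_inv_rev, affSwap_inv, hi, mul_affSwap hσ hdvd, h1, h2]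
    refine ⟨_, hw, .single hstep, hne _ .refl, hupper _ hw fun x => ?_⟩
    rw [Equiv.Perm.mul_apply]
    rcases affSwap_cases hdvd x with ⟨k, h3, h4⟩ | ⟨k, h3, h4⟩ | ⟨h4, _⟩
    · rw [h4, hσ.add_mul, h2]; linarith
    · rw [h4, hσ.add_mul, h1]; linarith
    · rw [h4]; exact hbu x

/-- The residues (in `{1, …, N}`) that `σ` moves by `c`. -/
noncomputable def movedBy (N : ℕ) (σ : Equiv.Perm ℤ) (c : ℤ) : Finset ℤ :=
  (Finset.Icc (1 : ℤ) N).filter fun x => σ x = x + c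

/-- Translation by `n` exchanges the two classes: `σ x = x + n` gives `σ (x + n) = x`. -/
theorem card_movedBy (hN : (N : ℤ) = 2 * n) (hn : 0 < n) (hσ : IsPeriodicPerm N σ)
    (hi : σ⁻¹ = σ) (hb : ∀ x, |σ x - x| = n) :
    (movedBy N σ n).card = n ∧ (movedBy N σ (-n)).card = n := by
  have hσσ := apply_apply_of_inv_eq hi
  have hσ' : ∀ x, σ (x - N) = σ x - N := fun x => by
    have := hσ (x - N)
    rw [sub_add_cancel] at this
    linarith
  have e1 : (movedBy N σ n).card = (movedBy N σ (-n)).card := by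
    refine Finset.card_nbij' (fun x => if x ≤ n then x + n else x - n)
      (fun x => if x ≤ n then x + n else x - n) ?_ ?_ ?_ ?_
    · intro x hx
      simp only [movedBy, Finset.coe_filter, Finset.mem_Icc, Set.mem_ofPred_eq] at hx ⊢
      have h1 := hσσ x
      rw [hx.2] at h1
      have h2 := hσ' (x + n)
      rw [show x + n - N = x - n by linarith] at h2
      split_ifs <;> refine ⟨⟨?_, ?_⟩, ?_⟩ <;> omega
    · intro x hx
      simp only [movedBy, Finset.coe_filter, Finset.mem_Icc, Set.mem_ofPred_eq] at hx ⊢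
      have h1 := hσσ x
      rw [hx.2] at h1
      have h2 := hσ (x + -n)
      rw [show x + -n + N = x + n by linarith] at h2
      rw [← sub_eq_add_neg] at h1 h2
      split_ifs <;> refine ⟨⟨?_, ?_⟩, ?_⟩ <;> omega
    · intro x hx
      simp only [movedBy, Finset.coe_filter, Finset.mem_Icc, Set.mem_ofPred_eq] at hx ⊢
      split_ifs <;> omega
    · intro x hx
      simp only [movedBy, Finset.coe_filter, Finset.mem_Icc, Set.mem_ofPred_eq] at hx ⊢
      split_ifs <;> omega
  have e2 : (movedBy N σ n).card + (movedBy N σ (-n)).card = N := by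
    have h := Finset.card_filter_add_card_filter_not (s := Finset.Icc (1 : ℤ) N)
      (fun x => σ x = x + n)
    have h' : (Finset.Icc (1 : ℤ) N).filter (fun x => ¬ σ x = x + n) = movedBy N σ (-n) := by
      apply Finset.filter_congr
      intro x _
      rcases eq_or_eq_neg_of_abs_eq (hb x) with h | h <;> constructor <;> intro h' <;> omega
    rw [h'] at h
    simpa [movedBy] using h
  omega

theorem two_mul_involutionRank_of_abs_eq (hN : (N : ℤ) = 2 * n) (hn : 0 < n)
    (hσ : IsPeriodicPerm N σ) (hi : σ⁻¹ = σ) (hb : ∀ x, |σ x - x| = n) :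
    2 * involutionRank N σ = n * n + n := by
  obtain ⟨c1, c2⟩ := card_movedBy hN hn hσ hi hb
  have hb' : ∀ x, σ x = x + n ∨ σ x = x + -n := fun x => by
    rcases eq_or_eq_neg_of_abs_eq (hb x) with h | h
    · left; omega
    · right; omega
  rw [two_mul_involutionRank (by omega) hσ hi]
  congr 1
  -- An inversion is an `x` moved up and a `y` moved down with `x < y < x + 2n`. Each pair of
  -- residues has exactly one such `y`, so there are `n * n` inversions.
  · have : {p | p ∈ invSet σ ∧ 1 ≤ p.1 ∧ p.1 ≤ N} =
        (fun p : ℤ × ℤ => (p.1, if p.1 < p.2 then p.2 else p.2 + N)) ''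
          (movedBy N σ n ×ˢ movedBy N σ (-n) : Finset (ℤ × ℤ)) := by
      ext ⟨x, y⟩
      simp only [invSet, Set.mem_image, Set.mem_ofPred_eq, movedBy, Finset.coe_product,
        Set.mem_prod, Finset.coe_filter, Finset.mem_Icc, Prod.exists, Prod.mk.injEq]
      constructor
      · rintro ⟨⟨h1, h2⟩, h3, h4⟩
        have hx := hb' x
        have hy := hb' y
        have hy' := hσ (y - N)
        rw [sub_add_cancel] at hy'
        by_cases hyN : y ≤ N
        · exact ⟨x, y, ⟨⟨⟨h3, h4⟩, by omega⟩, ⟨by omega, by omega⟩, by omega⟩, rfl, if_pos h1⟩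
        · refine ⟨x, y - N, ⟨⟨⟨h3, h4⟩, by omega⟩, ⟨by omega, by omega⟩, by omega⟩, rfl, ?_⟩
          rw [if_neg (by omega)]
          ring
      · rintro ⟨x', z, ⟨⟨⟨h1, h2⟩, h3⟩, ⟨h4, h5⟩, h6⟩, rfl, rfl⟩
        refine ⟨?_, h1, h2⟩
        have hz := hσ z
        split_ifs with h
        · omega
        · have : x' ≠ z := by
            rintro rfl
            omega
          omega
    rw [affLength, orbitCount, this, Set.InjOn.ncard_image, Set.ncard_coe_finset,
      Finset.card_product, c1, c2]
    rintro ⟨x, y⟩ h ⟨x', y'⟩ h' e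
    simp only [movedBy, Finset.coe_product, Set.mem_prod, Finset.coe_filter, Finset.mem_Icc,
      Set.mem_ofPred_eq, Prod.mk.injEq] at h h' e ⊢
    obtain ⟨rfl, e⟩ := e
    refine ⟨rfl, ?_⟩
    split_ifs at e <;> omega
  · have : {p | p ∈ cycleSet σ ∧ 1 ≤ p.1 ∧ p.1 ≤ N} =
        (fun x : ℤ => (x, σ x)) '' (movedBy N σ n : Finset ℤ) := by
      ext ⟨x, y⟩
      simp only [cycleSet, Set.mem_image, Set.mem_ofPred_eq, movedBy, Finset.coe_filter,
        Finset.mem_Icc, Prod.mk.injEq]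
      constructor
      · rintro ⟨⟨h1, h2⟩, h3, h4⟩
        have hx := hb' x
        exact ⟨x, ⟨⟨h3, h4⟩, by omega⟩, rfl, h2⟩
      · rintro ⟨x', ⟨⟨h1, h2⟩, h3⟩, rfl, rfl⟩
        exact ⟨⟨by omega, rfl⟩, h1, h2⟩
    rw [orbitCount, this, Set.InjOn.ncard_image, Set.ncard_coe_finset, c1]
    intro x _ x' _ e
    exact (Prod.mk.inj e).1

end bounded

/-- A periodic permutation permutes the residues modulo `N`. -/
theorem sum_comp_of_periodic {N : ℕ} (hN : 0 < N) {h : ℤ → ℤ}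
    (hh : ∀ x m : ℤ, h (x + m * N) = h x) {t : Equiv.Perm ℤ} (ht : IsPeriodicPerm N t) :
    ∑ x ∈ Finset.Icc (1 : ℤ) N, h (t x) = ∑ x ∈ Finset.Icc (1 : ℤ) N, h x := by
  have hN' : (0 : ℤ) < N := by exact_mod_cast hN
  have hex : ∀ x : ℤ, ∃ m : ℤ, 1 ≤ t x + m * N ∧ t x + m * N ≤ N := fun x =>
    ⟨_, normPair_mem hN (t x, 0)⟩
  choose m hm1 hm2 using hex
  have hmaps : Set.MapsTo (fun x => t x + m x * N) (Finset.Icc (1 : ℤ) N : Finset ℤ)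
      (Finset.Icc (1 : ℤ) N : Finset ℤ) := fun x _ => by simp [hm1, hm2]
  have hinj : Set.InjOn (fun x => t x + m x * N) (Finset.Icc (1 : ℤ) N : Finset ℤ) := by
    intro x hx y hy hxy
    simp only [Finset.coe_Icc, Set.mem_Icc] at hx hy hxy
    rw [← ht.add_mul, ← ht.add_mul] at hxy
    have hxy := t.injective hxy
    have e : x + (m x - m y) * N = y := by linarith
    have := eq_of_mem_window hx.1 hx.2 (m := m x - m y) (by rw [e]; exact hy.1)
      (by rw [e]; exact hy.2)
    rw [this] at e
    simpa using e
  exact Finset.sum_nbij (fun x => t x + m x * N) hmaps hinj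
    (Finset.surjOn_of_injOn_of_card_le _ hmaps hinj le_rfl) fun x _ => (hh _ _).symm

/-! ### Transfer to affine permutations. -/

namespace AffinePerm

variable {N : ℕ} {k : ℤ} {f g : AffinePerm N k}

theorem isPeriodicPerm (f : AffinePerm N k) : IsPeriodicPerm N f.toPerm := f.map_add_period

theorem length_eq_affLength (f : AffinePerm N k) : f.length = affLength N f.toPerm := by
  unfold length affLength orbitCount
  congr 1
  ext p
  simp only [inversions, invSet, Set.mem_ofPred_eq]
  tauto

/-- Right multiplication by an affine transposition. -/
def mulSwap (hN : 0 < N) (f : AffinePerm N k) (a b : ℤ) : AffinePerm N k where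
  toPerm := f.toPerm * affSwap N a b
  map_add_period := f.isPeriodicPerm.mul isPeriodicPerm_affSwap
  sum_sub := by
    have ht := isPeriodicPerm_affSwap (N := N) (a := a) (b := b)
    have h1 := sum_comp_of_periodic hN (h := fun x => f.toPerm x - x)
      (fun x m => by simp only [f.isPeriodicPerm.add_mul]; ring) ht
    have h2 := sum_comp_of_periodic hN (h := fun x => affSwap N a b x - x)
      (fun x m => by simp only [ht.add_mul]; ring) ht
    simp only [affSwap_affSwap] at h2
    have h3 : ∑ x ∈ Finset.Icc (1 : ℤ) N, (affSwap N a b x - x) = 0 := by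
      have : ∑ x ∈ Finset.Icc (1 : ℤ) N, (x - affSwap N a b x) =
          -∑ x ∈ Finset.Icc (1 : ℤ) N, (affSwap N a b x - x) := by
        rw [← Finset.sum_neg_distrib]
        exact Finset.sum_congr rfl fun x _ => by ring
      omega
    calc ∑ x ∈ Finset.Icc (1 : ℤ) N, ((f.toPerm * affSwap N a b) x - x)
        = ∑ x ∈ Finset.Icc (1 : ℤ) N, (f.toPerm (affSwap N a b x) - affSwap N a b x) +
          ∑ x ∈ Finset.Icc (1 : ℤ) N, (affSwap N a b x - x) := by
          rw [← Finset.sum_add_distrib]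
          exact Finset.sum_congr rfl fun x _ => by simp
      _ = k * N := by rw [h1, h3, f.sum_sub, add_zero]

/-- A reflection lengthens `f` exactly when it swaps values that were in increasing order; in the
other case it is `f` that is obtained from `g` by a lengthening swap. -/
theorem bruhatStep_iff (hN : 0 < N) : BruhatStep f g ↔ PermStep N f.toPerm g.toPerm := by
  constructor
  · rintro ⟨i, j, t, ht, hg, hlt⟩
    have main : ∀ a b : ℤ, IsTransposition N a b t → a < b → PermStep N f.toPerm g.toPerm := by
      intro a b ht hab
      have hd := ht.not_dvd
      rw [ht.eq_affSwap] at hg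
      refine ⟨a, b, hd, hab, ?_, hg⟩
      by_contra! h
      have hne : f.toPerm a ≠ f.toPerm b := fun e => hab.ne (f.toPerm.injective e)
      have h1 := affLength_lt hN g.isPeriodicPerm hd hab (by
        rw [hg]
        simp only [Equiv.Perm.mul_apply, affSwap_apply_left hd, affSwap_apply_right hd]
        omega)
      rw [hg, mul_assoc, affSwap_mul_self, mul_one, ← hg, ← length_eq_affLength,
        ← length_eq_affLength] at h1
      omega
    rcases lt_trichotomy i j with h | h | h
    · exact main i j ht h
    · exact absurd (by rw [h]) ht.1
    · exact main j i ht.comm h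
  · rintro ⟨a, b, hd, hab, hlt, hg⟩
    refine ⟨a, b, _, isTransposition_affSwap hd, hg, ?_⟩
    rw [length_eq_affLength, length_eq_affLength, hg]
    exact affLength_lt hN f.isPeriodicPerm hd hab hlt

theorem permLE_of_le (hN : 0 < N) (h : f ≤ g) : PermLE N f.toPerm g.toPerm := by
  change Relation.ReflTransGen BruhatStep f g at h
  exact h.lift AffinePerm.toPerm fun _ _ h => (bruhatStep_iff hN).1 h

theorem exists_le_of_permLE (hN : 0 < N) {w : Equiv.Perm ℤ} (h : PermLE N f.toPerm w) :
    ∃ g : AffinePerm N k, f ≤ g ∧ g.toPerm = w := by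
  induction h with
  | refl => exact ⟨f, le_rfl, rfl⟩
  | tail _ h2 ih =>
    obtain ⟨g, hg, rfl⟩ := ih
    obtain ⟨a, b, hd, hab, hlt, rfl⟩ := h2
    refine ⟨g.mulSwap hN a b, Relation.ReflTransGen.tail hg ?_, rfl⟩
    exact (bruhatStep_iff hN).2 ⟨a, b, hd, hab, hlt, rfl⟩

theorem le_iff_permLE (hN : 0 < N) : f ≤ g ↔ PermLE N f.toPerm g.toPerm := by
  refine ⟨permLE_of_le hN, fun h => ?_⟩
  obtain ⟨g', h1, h2⟩ := exists_le_of_permLE hN h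
  rwa [AffinePerm.ext h2] at h1

end AffinePerm

theorem PermLE.translate {N : ℕ} {f g : Equiv.Perm ℤ} (c : ℤ) (h : PermLE N f g) :
    PermLE N (Equiv.addRight c * f) (Equiv.addRight c * g) := by
  induction h with
  | refl => exact .refl
  | tail _ h ih =>
    obtain ⟨a, b, hd, hab, hlt, rfl⟩ := h
    exact ih.tail ⟨a, b, hd, hab, by simpa using hlt, rfl⟩

/-- Boundedness passes to smaller elements in the Bruhat order. -/
theorem PermLE.abs_sub_le {N n : ℕ} {v w : Equiv.Perm ℤ} (h : PermLE N v w)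
    (hv : IsPeriodicPerm N v) (hw : ∀ x, |w x - x| ≤ n) : ∀ x, |v x - x| ≤ n := by
  induction h with
  | refl => exact hw
  | tail h1 h2 ih =>
    refine ih fun x => ?_
    have hp := PermLE.isPeriodicPerm h1 hv
    obtain ⟨a, b, hd, hab, hlt, rfl⟩ := h2
    have ha := abs_le.1 (hw a)
    have hb := abs_le.1 (hw b)
    have hx := abs_le.1 (hw x)
    rw [abs_le]
    simp only [Equiv.Perm.mul_apply, affSwap_apply_left hd, affSwap_apply_right hd] at ha hb hx
    -- Undoing the swap makes both displacements, at `a` and at `b`, lie between the old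
    -- displacements `w b - b` and `w a - a`.
    rcases affSwap_cases hd x with ⟨m, h3, h4⟩ | ⟨m, h3, h4⟩ | ⟨h4, _⟩
    · rw [h3, hp.add_mul]
      constructor <;> linarith
    · rw [h3, hp.add_mul]
      constructor <;> linarith
    · rwa [h4] at hx

/-! ### Symmetric bounded permutations as bounded involutions. -/

namespace SymmBoundedPerm

variable {n : ℕ}

/-- The involution `i ↦ f i - n`. -/
def involution (f : SymmBoundedPerm n) : Equiv.Perm ℤ :=
  Equiv.addRight (-(n : ℤ)) * f.toAffinePerm.toPerm

theorem involution_apply (f : SymmBoundedPerm n) (x : ℤ) : f.involution x = f x - n := by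
  simp [involution, sub_eq_add_neg]

theorem addRight_mul_involution (f : SymmBoundedPerm n) :
    Equiv.addRight (n : ℤ) * f.involution = f.toAffinePerm.toPerm := by
  ext x; simp [involution]

theorem apply_eq (f : SymmBoundedPerm n) (x : ℤ) : f x = f.involution x + n := by
  rw [involution_apply]; ring

theorem involution_inv (f : SymmBoundedPerm n) : f.involution⁻¹ = f.involution := by
  rw [← mul_eq_one_iff_inv_eq]
  ext x
  have := f.symm x
  simpa [involution_apply] using this

theorem involution_isPeriodicPerm (f : SymmBoundedPerm n) :
    IsPeriodicPerm (2 * n) f.involution := fun x => by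
  rw [involution_apply, involution_apply, f.toAffinePerm.map_add_period]; ring

theorem abs_involution_sub_le (f : SymmBoundedPerm n) (x : ℤ) : |f.involution x - x| ≤ n := by
  have := f.bounded x
  rw [involution_apply, abs_le]
  push_cast at this
  constructor <;> linarith [this.1, this.2]

theorem le_iff_permLE (hn : 0 < n) {f g : SymmBoundedPerm n} :
    f ≤ g ↔ PermLE (2 * n) g.involution f.involution := by
  have : f ≤ g ↔ g.toAffinePerm ≤ f.toAffinePerm := Iff.rfl
  rw [this, AffinePerm.le_iff_permLE (by omega)]
  refine ⟨fun h => h.translate _, fun h => ?_⟩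
  have := h.translate (n : ℤ)
  rwa [addRight_mul_involution, addRight_mul_involution] at this

theorem involution_injective {f g : SymmBoundedPerm n} (h : f.involution = g.involution) :
    f = g :=
  SymmBoundedPerm.ext (AffinePerm.ext (mul_left_cancel h))

theorem exists_of_permLE (hn : 0 < n) (f : SymmBoundedPerm n) {w : Equiv.Perm ℤ}
    (h : PermLE (2 * n) f.involution w) (hi : w⁻¹ = w) (hb : ∀ x, |w x - x| ≤ n) :
    ∃ g : SymmBoundedPerm n, g.involution = w := by
  have h' := h.translate (n : ℤ)
  rw [addRight_mul_involution] at h'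
  obtain ⟨g, -, hg⟩ := AffinePerm.exists_le_of_permLE (by omega) h'
  have hg' : ∀ x, g x = w x + n := fun x => by rw [hg]; simp
  refine ⟨⟨g, fun x => ?_, fun x => ?_⟩, ?_⟩
  · have := abs_le.1 (hb x)
    rw [hg']
    push_cast
    constructor <;> linarith
  · simp only [hg', add_sub_cancel_right]
    exact apply_apply_of_inv_eq hi x
  · ext x
    simp [involution_apply, hg']

/-- Needed because equality in `Quot` only means equivalence under the generated relation. Pairing
twice translates by two periods, whence the shifts by `2`. -/
theorem Alignment.rel_equivalence (f : SymmBoundedPerm n) :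
    Equivalence (Alignment.Rel f) := by
  have hσσ := apply_apply_of_inv_eq f.involution_inv
  have hp : ∀ x m : ℤ, f.involution (x + n + n + m * (2 * n)) =
      f.involution x + n + n + m * (2 * n) := fun x m => by
    have := f.involution_isPeriodicPerm.add_mul x (m + 1)
    push_cast at this
    rw [show x + n + n + m * (2 * n) = x + (m + 1) * (2 * n) by ring, this]
    ring
  have hp' : ∀ x m : ℤ, f.involution (x + m * (2 * n)) =
      f.involution x + m * (2 * n) := fun x m => by
    have := f.involution_isPeriodicPerm.add_mul x m
    push_cast at this
    exact this
  refine ⟨fun p => ⟨0, Or.inl (by simp)⟩, ?_, ?_⟩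
  · rintro ⟨⟨x, y⟩, _⟩ ⟨⟨x', y'⟩, _⟩ ⟨m, h | h⟩
    · simp only [Prod.mk.injEq] at h
      refine ⟨-m, Or.inl ?_⟩
      simp only [h.1, h.2, Prod.mk.injEq]
      constructor <;> ring
    · simp only [apply_eq, Prod.mk.injEq] at h
      refine ⟨-m - 2, Or.inr ?_⟩
      simp only [apply_eq, h.1, h.2, hp, hσσ, Prod.mk.injEq]
      constructor <;> ring
  · rintro ⟨⟨x, y⟩, _⟩ ⟨⟨x', y'⟩, _⟩ ⟨⟨x'', y''⟩, _⟩ ⟨m, h | h⟩ ⟨k, h' | h'⟩ <;>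
    simp only [apply_eq, Prod.mk.injEq] at h h'
    · refine ⟨m + k, Or.inl ?_⟩
      simp only [h'.1, h'.2, h.1, h.2, Prod.mk.injEq]
      constructor <;> ring
    · refine ⟨m + k, Or.inr ?_⟩
      simp only [apply_eq, h'.1, h'.2, h.1, h.2, hp', Prod.mk.injEq]
      constructor <;> ring
    · refine ⟨m + k, Or.inr ?_⟩
      simp only [apply_eq, h'.1, h'.2, h.1, h.2, Prod.mk.injEq]
      constructor <;> ring
    · refine ⟨m + k + 2, Or.inl ?_⟩
      simp only [h'.1, h'.2, h.1, h.2, hp, hσσ, Prod.mk.injEq]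
      constructor <;> ring

theorem symmLength_eq_involutionRank (hn : 0 < n) (f : SymmBoundedPerm n) :
    f.symmLength = involutionRank (2 * n) f.involution := by
  have hσσ := apply_apply_of_inv_eq f.involution_inv
  have hbd : ∀ x, x ≤ f.involution x + n := fun x => by
    have := abs_le.1 (f.abs_involution_sub_le x)
    linarith
  have hper : ∀ x m : ℤ, f.involution (x + m * (2 * n)) =
      f.involution x + m * (2 * n) := fun x m => by
    have := f.involution_isPeriodicPerm.add_mul x m
    push_cast at this
    exact this
  have hmem : ∀ p : ℤ × ℤ, p ∈ invSet f.involution → p.1 < p.2 ∧ p.2 ≤ f p.2 ∧ f p.2 < f p.1 := by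
    rintro ⟨x, y⟩ ⟨h1, h2⟩
    simp only [apply_eq]
    exact ⟨h1, hbd y, by simpa using h2⟩
  have hsub : ∀ p ∈ symmInvSet f.involution, p ∈ invSet f.involution :=
    fun p hp => ⟨hp.1, hp.2.2⟩
  unfold symmLength involutionRank orbitCount
  rw [← Nat.card_coe_set_eq]
  symm
  refine Nat.card_eq_of_bijective
    (fun p => Quot.mk (Alignment.Rel f) ⟨p.1, hmem _ (hsub _ p.2.1)⟩) ⟨?_, ?_⟩
  · rintro ⟨⟨x, y⟩, ⟨h1, h2, h3⟩, h4, h5⟩ ⟨⟨x', y'⟩, ⟨h1', h2', h3'⟩, h4', h5'⟩ h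
    have h6 : x' ≤ 2 * (n : ℤ) := by exact_mod_cast h5'
    obtain ⟨m, h | h⟩ := ((Alignment.rel_equivalence f).quot_mk_eq_iff _ _).1 h
    · simp only [Prod.mk.injEq] at h h4 h5 h4' h5'
      have hm : m = 0 := eq_of_mem_window h4 h5 (by push_cast; linarith)
        (by push_cast; linarith)
      subst hm
      simp only [zero_mul, add_zero] at h
      simp [h.1, h.2]
    -- Two representatives that are mirror images satisfy `x ≤ σ y` and the reverse inequality, so
    -- they form a two-cycle and coincide once the window fixes the shift.
    · simp only [apply_eq, Prod.mk.injEq] at h h4 h5 h4' h5' h2 h2'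
      have e : f.involution y' = x + (m + 1) * (2 * n) := by
        rw [h.2, show f.involution x + n + n + m * (2 * (n : ℤ)) =
          f.involution x + (m + 1) * (2 * n) by ring, hper, hσσ]
      have e2 : x = f.involution y := by linarith [h.1]
      have e3 : f.involution x = y := by rw [e2, hσσ]
      have hm : m + 1 = 0 := by
        refine eq_of_mem_window (N := 2 * n) h4 h5 ?_ ?_ <;> push_cast <;> linarith [h.1]
      have hm' : m = -1 := by omega
      subst hm'
      simp only [Subtype.mk.injEq, Prod.mk.injEq]
      constructor <;> linarith [h.1, h.2]
  · intro q
    induction q using Quot.ind with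
    | mk p =>
      obtain ⟨⟨x, y⟩, h1, h2, h3⟩ := p
      simp only [apply_eq] at h1 h2 h3
      by_cases hxy : x ≤ f.involution y
      · have hm : (x, y) ∈ symmInvSet f.involution := ⟨h1, hxy, by simpa using h3⟩
        refine ⟨⟨normPair (2 * n) (x, y),
          f.involution_isPeriodicPerm.shiftPair_mem_symmInvSet _ hm _,
          normPair_mem (by omega) _⟩, ?_⟩
        symm
        refine Quot.sound ⟨-((x - 1) / ((2 * n : ℕ) : ℤ)), Or.inl ?_⟩
        simp only [normPair, shiftPair]
        push_cast
        rfl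
      · have hm : (f.involution y, f.involution x) ∈ symmInvSet f.involution := by
          refine ⟨by simpa using h3, ?_, ?_⟩ <;> simp only [hσσ]
          · omega
          · exact h1
        refine ⟨⟨normPair (2 * n) (f.involution y, f.involution x),
          f.involution_isPeriodicPerm.shiftPair_mem_symmInvSet _ hm _,
          normPair_mem (by omega) _⟩, ?_⟩
        symm
        -- The extra `- 1` compensates for `f y + n = σ y + 2n`.
        refine Quot.sound ⟨-((f.involution y - 1) / ((2 * n : ℕ) : ℤ)) - 1, Or.inr ?_⟩
        simp only [normPair, shiftPair, apply_eq, Prod.mk.injEq]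
        push_cast
        constructor <;> ring

theorem symmDim_eq (hn : 0 < n) (f : SymmBoundedPerm n) :
    f.symmDim = ((n + 1).choose 2 : ℤ) - involutionRank (2 * n) f.involution := by
  rw [symmDim, symmLength_eq_involutionRank hn]

theorem symmDim_eq_zero_of_isMin (hn : 0 < n) {f : SymmBoundedPerm n} (hf : IsMin f) :
    f.symmDim = 0 := by
  have hN : ((2 * n : ℕ) : ℤ) = 2 * n := by push_cast; rfl
  by_cases hx : ∃ x, |f.involution x - x| < n
  · obtain ⟨w, hw, hle, hne, hb⟩ := exists_larger_involution hN f.involution_isPeriodicPerm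
      f.involution_inv f.abs_involution_sub_le hx
    obtain ⟨g, rfl⟩ := f.exists_of_permLE hn hle hw hb
    have h1 := hf ((le_iff_permLE hn).2 hle)
    exact absurd (PermLE.antisymm (by omega) f.involution_isPeriodicPerm hle
      ((le_iff_permLE hn).1 h1)) hne
  · have h := two_mul_involutionRank_of_abs_eq hN hn f.involution_isPeriodicPerm f.involution_inv
      fun x => le_antisymm (f.abs_involution_sub_le x) (not_lt.1 fun h => hx ⟨x, h⟩)
    rw [symmDim_eq hn, Nat.choose_two_right, Nat.add_sub_cancel,
      show (n + 1) * n = n * n + n by ring, ← h]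
    simp

theorem involutionRank_lt_of_lt (hn : 0 < n) {f g : SymmBoundedPerm n} (h : f < g) :
    involutionRank (2 * n) g.involution < involutionRank (2 * n) f.involution :=
  (PermLE.involutionRank_lt_and_exists (by omega) _ _ _ le_rfl g.involution_isPeriodicPerm
    g.involution_inv f.involution_inv ((le_iff_permLE hn).1 h.le)
    fun e => h.ne' (involution_injective e)).1

/-- The grading gives an involution between `g.involution` and `f.involution`; it is bounded because
it lies below `f.involution`, so the cover leaves only `f` for it. -/
theorem involutionRank_eq_of_covBy (hn : 0 < n) {f g : SymmBoundedPerm n} (h : f ⋖ g) :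
    involutionRank (2 * n) f.involution = involutionRank (2 * n) g.involution + 1 := by
  have hle := (le_iff_permLE hn).1 h.le
  obtain ⟨-, v, hv, h1, h2, h3⟩ := PermLE.involutionRank_lt_and_exists (by omega) _ _ _ le_rfl
    g.involution_isPeriodicPerm g.involution_inv f.involution_inv hle
    fun e => h.ne' (involution_injective e)
  have hb := h2.abs_sub_le (h1.isPeriodicPerm g.involution_isPeriodicPerm) f.abs_involution_sub_le
  obtain ⟨z, rfl⟩ := g.exists_of_permLE hn h1 hv hb
  rcases h.eq_or_eq ((le_iff_permLE hn).2 h2) ((le_iff_permLE hn).2 h1) with e | e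
  · rwa [e] at h3
  · rw [e] at h3
    omega

theorem symmDim_nonneg (hn : 0 < n) (f : SymmBoundedPerm n) : 0 ≤ f.symmDim := by
  -- A uniform bound on the rank: the inversions involved span at most `2n`. It makes the descent to
  -- a minimal element terminate.
  set B := orbitCount (2 * n) {p | |p.2 - p.1| ≤ 2 * (n : ℤ)} with hB
  have hle : ∀ f : SymmBoundedPerm n, involutionRank (2 * n) f.involution ≤ B := fun f => by
    refine orbitCount_mono (C := 2 * n) (fun p hp => hp) ?_
    rintro ⟨x, y⟩ ⟨h1, h2, h3⟩
    have hx := abs_le.1 (f.abs_involution_sub_le x)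
    have hy := abs_le.1 (f.abs_involution_sub_le y)
    simp only [Set.mem_ofPred_eq] at *
    rw [abs_le]
    constructor <;> linarith
  induction h : B - involutionRank (2 * n) f.involution using Nat.strong_induction_on
    generalizing f with
  | _ k ih =>
    by_cases hf : IsMin f
    · exact (symmDim_eq_zero_of_isMin hn hf).ge
    · obtain ⟨g, hg⟩ := not_isMin_iff.1 hf
      have hlt := involutionRank_lt_of_lt hn hg
      have hg' := hle g
      have h0 := ih _ (by omega) g rfl
      rw [symmDim_eq hn] at h0 ⊢
      omega

instance subsingleton_zero : Subsingleton (SymmBoundedPerm 0) where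
  allEq f g := by
    ext x
    have hf := f.bounded x
    have hg := g.bounded x
    simp only [mul_zero, Nat.cast_zero, add_zero] at hf hg
    omega

theorem symmDim_zero (f : SymmBoundedPerm 0) : f.symmDim = 0 := by
  have : IsEmpty f.Alignment := ⟨by
    rintro ⟨⟨x, y⟩, h1, h2, h3⟩
    have hf := f.bounded x
    simp only [mul_zero, Nat.cast_zero, add_zero] at hf h1 h2 h3
    omega⟩
  simp [symmDim, symmLength]

end SymmBoundedPerm

theorem mainTheorem7 (n : ℕ) :
    IsRankFunction (fun f : SymmBoundedPerm n => f.symmDim) := by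
  rcases Nat.eq_zero_or_pos n with rfl | hn
  · exact ⟨fun f => f.symmDim_zero.ge, fun f _ => f.symmDim_zero,
      fun f g h => absurd (Subsingleton.elim f g) h.ne,
      fun f g h => absurd (Subsingleton.elim f g) h.ne⟩
  · refine ⟨SymmBoundedPerm.symmDim_nonneg hn,
      fun f hf => SymmBoundedPerm.symmDim_eq_zero_of_isMin hn hf, fun f g h => ?_,
      fun f g h => ?_⟩
    · have := SymmBoundedPerm.involutionRank_lt_of_lt hn h
      simp only [SymmBoundedPerm.symmDim_eq hn]
      omega
    · have := SymmBoundedPerm.involutionRank_eq_of_covBy hn h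
      simp only [SymmBoundedPerm.symmDim_eq hn]
      omega
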